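/- Let $d_v,d_c\ge 1$ and $\ell\ge 0$ be integers. For $n,m$ with $nd_v=md_c$, draw a labeled $(d_v,d_c)$-regular bipartite factor graph with $n$ variable nodes and $m=nd_v/d_c$ check nodes uniformly at random, i.e. match the $nd_v$ variable-node sockets with the $md_c$ check-node sockets by a uniformly random bijection. The all-one codeword is sent over a memoryless channel with binary input alphabet $\{\pm1\}$ and output alphabet $\mathcal Y$, so the outputs $y_1,\dots,y_n$ are i.i.d. with the channel's output law given input $+1$. A noisy message-passing decoder with message alphabet $\mathcal M$ and noise alphabet $\mathcal U$ (arbitrary measurable spaces) works as follows. In iteration $0$ each variable node sends $\Psi^{(0)}(y,u)$ along each of its edges. In iteration $t\ge1$ each check node sends along each edge $\Phi^{(t)}(\mu_1,\dots,\mu_{d_c-1},u)$, computed from the messages received along its other $d_c-1$ edges, and then each variable node sends along each edge $\Psi^{(t)}(y,\mu_1,\dots,\mu_{d_v-1},u)$, computed from its channel output and the messages just received along its other $d_v-1$ edges; here $u\in\mathcal U$ is the computation noise of that node in that iteration. A message sent as $\nu$ is received as $\Xi(\nu,w)$, where $w\in\mathcal M$ is the noise of that wire in that iteration. All maps are measurable,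 and the graph, the channel outputs and all noises are independent; the law of a noise depends only on its kind (variable node, check node, variable-to-check wire, check-to-variable wire) and on the iteration. Messages carry a real or infinite belief value whose sign indicates the bit estimate; a received message is incorrect if its belief value is not positive. Let $Z$ be the number of incorrect messages among the $nd_v$ variable-to-check messages received (after wire noise) in iteration $\ell$. The directed neighborhood of depth $d$ of an edge $e$ at a variable node $v$ consists of the nodes and edges on the non-backtracking paths of length at most $d$ that start at $v$ and whose first edge is not $e$; it is tree-like if distinct such paths end in distinct nodes. Then there are positive constants $\beta,\gamma$ depending only on $(d_v,d_c,\ell)$ such that for every such channel and decoder there is a number $p$ with the following two properties. (i) $p$ is the expected number of incorrect messages received along a given edge in iteration $\ell$, given that the directed neighborhood of depth $2\ell$ of this edge is tree-like: for all $n$ and every edge $e$ for which this event has positive probability, the conditional probability, given this event, that the variable-to-check message received along $e$ in iteration $\ell$ is incorrect equals $p$. (ii) For every $\epsilon>0$ and every $n>2\gamma/\epsilon$ with $d_c\mid nd_v$, \[ \Pr\left[|Z-nd_vp|>nd_v\epsilon\right]\le 2e^{-\beta\epsilon^2n}. \] -/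

import Mathlib

open MeasureTheory ProbabilityTheory

noncomputable section

/-- A labeled `(dv, dc)`-regular bipartite factor graph with `n` variable nodes and `m` check
nodes: node `i` on the left has the sockets `(i, 0), …, (i, dv - 1)`, node `j` on the right has the
sockets `(j, 0), …, (j, dc - 1)`, and the edges match left sockets with right sockets. An edge is
named by its left socket; the graph sends it to its right socket. -/
abbrev FactorGraph (n dv m dc : ℕ) : Type := (Fin n × Fin dv) ≃ (Fin m × Fin dc)

instance (n dv m dc : ℕ) : MeasurableSpace (FactorGraph n dv m dc) := ⊤

/-- The sockets of a node of degree `d` other than `j`, listed in increasing order. -/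
def otherSocket {d : ℕ} (j : Fin d) (i : Fin (d - 1)) : Fin d :=
  if i.val < j.val then ⟨i.val, by omega⟩ else ⟨i.val + 1, by omega⟩

/-- `IsDirectedPath g e p x`: the edge list `p` (last edge first) is a path in the graph `g`,
without immediate reversals, that starts at the variable node of the edge `e`, does not start with
`e` itself, and ends at the node `x`; the nodes are `Sum.inl i` (variable) and `Sum.inr j`
(check). -/
inductive IsDirectedPath {n dv m dc : ℕ} (g : FactorGraph n dv m dc) (e : Fin n × Fin dv) :
    List (Fin n × Fin dv) → Fin n ⊕ Fin m → Prop
  | nil : IsDirectedPath g e [] (Sum.inl e.1)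
  | toCheck {p : List (Fin n × Fin dv)} {i : Fin n} (e' : Fin n × Fin dv) :
      IsDirectedPath g e p (Sum.inl i) → e'.1 = i → e' ≠ p.headD e →
      IsDirectedPath g e (e' :: p) (Sum.inr (g e').1)
  | toVar {p : List (Fin n × Fin dv)} {j : Fin m} (e' : Fin n × Fin dv) :
      IsDirectedPath g e p (Sum.inr j) → (g e').1 = j → e' ≠ p.headD e →
      IsDirectedPath g e (e' :: p) (Sum.inl e'.1)

/-- The directed neighborhood of depth `d` of the wire that leaves the variable node of `e` along
`e` is tree-like: all the nodes involved are distinct, that is, different paths of length at most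
`d` lead to different nodes. -/
def TreeLike {n dv m dc : ℕ} (g : FactorGraph n dv m dc) (e : Fin n × Fin dv) (d : ℕ) : Prop :=
  ∀ (p q : List (Fin n × Fin dv)) (x : Fin n ⊕ Fin m), p.length ≤ d → q.length ≤ d →
    IsDirectedPath g e p x → IsDirectedPath g e q x → p = q

/-- A binary-input memoryless channel with output alphabet `Y` and a noisy message-passing decoder
with message alphabet `M` and local noise alphabet `U`, for variable degree `dv` and check degree
`dc`. The maps and the noise laws may change with the iteration. -/
structure NoisySystem (dv dc : ℕ) (Y M U : Type*) [MeasurableSpace Y] [MeasurableSpace M]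
    [MeasurableSpace U] where
  /-- law of the channel output given the channel input in `{1, -1}` -/
  channel : ℤˣ → ProbabilityMeasure Y
  /-- variable node computation in iteration `0` -/
  varInit : Y → U → M
  /-- variable node computation in iteration `t ≥ 1` -/
  varMap : ℕ → Y → (Fin (dv - 1) → M) → U → M
  /-- check node computation in iteration `t ≥ 1` -/
  checkMap : ℕ → (Fin (dc - 1) → M) → U → M
  /-- received message, from the sent message and the wire noise -/
  wire : M → M → M
  /-- belief value of a message: its sign indicates the bit estimate -/
  belief : M → EReal
  /-- law of the computation noise of a variable node in iteration `t` -/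
  varNoise : ℕ → ProbabilityMeasure U
  /-- law of the computation noise of a check node in iteration `t` -/
  checkNoise : ℕ → ProbabilityMeasure U
  /-- law of the variable-to-check wire noise in iteration `t` -/
  wireNoiseVC : ℕ → ProbabilityMeasure M
  /-- law of the check-to-variable wire noise in iteration `t` -/
  wireNoiseCV : ℕ → ProbabilityMeasure M
  measurable_varInit : Measurable fun x : Y × U => varInit x.1 x.2
  measurable_varMap : ∀ t, Measurable fun x : Y × (Fin (dv - 1) → M) × U =>
    varMap t x.1 x.2.1 x.2.2
  measurable_checkMap : ∀ t, Measurable fun x : (Fin (dc - 1) → M) × U => checkMap t x.1 x.2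
  measurable_wire : Measurable fun x : M × M => wire x.1 x.2
  measurable_belief : Measurable belief

/-- Realizations of: the graph, the `n` channel outputs, the variable node noises and the
variable-to-check wire noises of the iterations `0, …, ℓ`, the check node noises and the
check-to-variable wire noises of the iterations `1, …, ℓ`. -/
abbrev SampleSpace (n dv m dc : ℕ) (Y M U : Type*) (ℓ : ℕ) : Type _ :=
  FactorGraph n dv m dc × (Fin n → Y) ×
    (Fin (ℓ + 1) → Fin n → U) × (Fin (ℓ + 1) → Fin n × Fin dv → M) ×
    (Fin ℓ → Fin m → U) × (Fin ℓ → Fin n × Fin dv → M)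

namespace NoisySystem

variable {dv dc : ℕ} {Y M U : Type*} [MeasurableSpace Y] [MeasurableSpace M] [MeasurableSpace U]

/-- The messages that the variable nodes receive in iteration `t`, one for each edge, when the
messages received by the check nodes in iteration `t - 1` are `prev`, the noise of the check nodes
is `u` and the wire noise is `w`. The message sent along an edge is computed from those received
along the other edges of the check node. -/
def checkStep {n m : ℕ} (D : NoisySystem dv dc Y M U) (g : FactorGraph n dv m dc) (t : ℕ)
    (prev : Fin n × Fin dv → M) (u : Fin m → U) (w : Fin n × Fin dv → M)
    (e : Fin n × Fin dv) : M :=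
  D.wire (D.checkMap t (fun k => prev (g.symm ((g e).1, otherSocket (g e).2 k))) (u (g e).1)) (w e)

/-- The messages that the check nodes receive in iteration `t ≥ 1`, one for each edge, when the
channel outputs are `y`, the messages received by the variable nodes in iteration `t` are `inc`,
the noise of the variable nodes is `u` and the wire noise is `w`. -/
def varStep {n : ℕ} (D : NoisySystem dv dc Y M U) (t : ℕ) (y : Fin n → Y)
    (inc : Fin n × Fin dv → M) (u : Fin n → U) (w : Fin n × Fin dv → M)
    (e : Fin n × Fin dv) : M :=
  D.wire (D.varMap t (y e.1) (fun k => inc (e.1, otherSocket e.2 k)) (u e.1)) (w e)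

/-- The message received by the check node (after wire noise) along each edge in iteration
`t ≤ ℓ`. -/
def received {n m ℓ : ℕ} (D : NoisySystem dv dc Y M U) (g : FactorGraph n dv m dc)
    (y : Fin n → Y) (uv : Fin (ℓ + 1) → Fin n → U) (wvc : Fin (ℓ + 1) → Fin n × Fin dv → M)
    (uc : Fin ℓ → Fin m → U) (wcv : Fin ℓ → Fin n × Fin dv → M) :
    (t : ℕ) → t ≤ ℓ → Fin n × Fin dv → M
  | 0, _ => fun e => D.wire (D.varInit (y e.1) (uv 0 e.1)) (wvc 0 e)
  | t + 1, h =>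
      D.varStep (t + 1) y
        (D.checkStep g (t + 1) (D.received g y uv wvc uc wcv t (by omega))
          (uc ⟨t, by omega⟩) (wcv ⟨t, by omega⟩))
        (uv ⟨t + 1, by omega⟩) (wvc ⟨t + 1, by omega⟩)

/-- The message received along the edge `e` in iteration `ℓ`, as a random variable. -/
def message {n m ℓ : ℕ} (D : NoisySystem dv dc Y M U) (e : Fin n × Fin dv)
    (ω : SampleSpace n dv m dc Y M U ℓ) : M :=
  D.received ω.1 ω.2.1 ω.2.2.1 ω.2.2.2.1 ω.2.2.2.2.1 ω.2.2.2.2.2 ℓ le_rfl e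

/-- The incorrect messages, when the all-one codeword is sent: those that do not indicate the
bit `+1`. -/
def incorrect (D : NoisySystem dv dc Y M U) : Set M := {μ | ¬ 0 < D.belief μ}

/-- The number `Z` of incorrect messages among the `n * dv` messages received in iteration `ℓ`. -/
def numIncorrect {n m ℓ : ℕ} (D : NoisySystem dv dc Y M U)
    (ω : SampleSpace n dv m dc Y M U ℓ) : ℕ :=
  ∑ e : Fin n × Fin dv, D.incorrect.indicator (fun _ => 1) (D.message e ω)

/-- The probability measure: the graph is uniformly distributed, the all-one codeword is sent, and
the channel outputs and all decoder noises are independent, also of the graph. -/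
def law (D : NoisySystem dv dc Y M U) (n m ℓ : ℕ) : Measure (SampleSpace n dv m dc Y M U ℓ) :=
  (uniformOn (Set.univ : Set (FactorGraph n dv m dc))).prod <|
  (Measure.pi fun _ : Fin n => (D.channel 1 : Measure Y)).prod <|
  (Measure.pi fun t : Fin (ℓ + 1) => Measure.pi fun _ : Fin n =>
    (D.varNoise t : Measure U)).prod <|
  (Measure.pi fun t : Fin (ℓ + 1) => Measure.pi fun _ : Fin n × Fin dv =>
    (D.wireNoiseVC t : Measure M)).prod <|
  (Measure.pi fun t : Fin ℓ => Measure.pi fun _ : Fin m =>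
    (D.checkNoise (t + 1) : Measure U)).prod <|
  (Measure.pi fun t : Fin ℓ => Measure.pi fun _ : Fin n × Fin dv =>
    (D.wireNoiseCV (t + 1) : Measure M))

/-- The event that the directed neighborhood of depth `2 * ℓ` of the edge `e` is tree-like. -/
def treeEvent (Y M U : Type*) {n dv m dc ℓ : ℕ} (e : Fin n × Fin dv) :
    Set (SampleSpace n dv m dc Y M U ℓ) :=
  {ω | TreeLike ω.1 e (2 * ℓ)}

end NoisySystem

end

/-!
The number `p` is the error probability of the root of an abstract computation tree with independent
noise (`NoisySystem.treeError`). The nodes of this tree are words of socket choices, so the tree does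
not refer to any factor graph. In a factor graph, the message received along an edge `e` is always
the root message of the tree, evaluated at the noise read along the words that start at `e`
(`NoisySystem.message_eq_treeMessage`). If the neighborhood of `e` is tree-like, then distinct words
lead to distinct nodes, and since restricting a product measure along an injection gives a product
measure (`measurePreserving_pi_precomp`), the message has exactly the law of the tree message. This
gives the first property, graph by graph.

For the second property, the deviation of `Z` from `n * dv * p` is split into bias and fluctuation.
The bias is at most half of `n * dv * ε` once `n` is large, so that the fluctuation has to exceed the
other half.

* Bias. It is at most the expected number of edges without tree-like neighborhood, which is bounded
  independently of `n` (`NoisySystem.abs_integral_numIncorrect_sub_le`). Two paths that meet, taken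
  as short as possible, share no occurrence of their last edge, and switching the right socket of
  this edge with that of a generic edge separates them. As the switched pair can be found again near
  `e`, up to a bounded number of choices, such graphs have probability `O(1 / n)`
  (`card_not_treeLike_mul_le`).
* Fluctuation. Changing one noise variable, or switching two edges, changes a bounded number of
  messages (`NoisySystem.abs_numIncorrect_sub_le`). In place of an exposure martingale, the
  sub-Gaussian bound for functions with bounded differences is tensorized over products
  (`SubgaussianDiff.prod`, `SubgaussianDiff.pi`) and, by induction on the number of elements, over
  uniform permutations (`subgaussianDiff_perm`). The total variance proxy is of order `n`, and
  Chernoff's bound gives the exponential tail.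
-/

noncomputable section

/-! ### Neighborhoods that are not tree-like -/

namespace IsDirectedPath

variable {n m dv dc : ℕ} {g g' : FactorGraph n dv m dc} {e e' : Fin n × Fin dv}
  {p q l : List (Fin n × Fin dv)} {x y : Fin n ⊕ Fin m}

theorem cons_inv (h : IsDirectedPath g e (e' :: p) x) :
    ∃ y, IsDirectedPath g e p y ∧ e' ≠ p.headD e ∧
      ((y = Sum.inl e'.1 ∧ x = Sum.inr (g e').1) ∨ (y = Sum.inr (g e').1 ∧ x = Sum.inl e'.1)) := by
  cases h with
  | toCheck _ h1 h2 h3 => exact ⟨_, h1, h3, Or.inl ⟨by rw [h2], rfl⟩⟩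
  | toVar _ h1 h2 h3 => exact ⟨_, h1, h3, Or.inr ⟨by rw [h2], rfl⟩⟩

theorem of_append (h : IsDirectedPath g e (l ++ p) x) : ∃ y, IsDirectedPath g e p y := by
  induction l generalizing x with
  | nil => exact ⟨x, h⟩
  | cons a l ih =>
    obtain ⟨y, hy, -⟩ := h.cons_inv
    exact ih hy

/-- Whether an edge list is a directed path depends on the graph only through its own edges. -/
theorem congr (h : IsDirectedPath g e p x) (hg : ∀ a ∈ p, g' a = g a) :
    IsDirectedPath g' e p x := by
  induction h with
  | nil => exact .nil
  | toCheck a h1 h2 h3 ih =>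
    rw [← hg a (by simp)]
    exact .toCheck a (ih fun b hb => hg b (by simp [hb])) h2 h3
  | toVar a h1 h2 h3 ih =>
    exact .toVar a (ih fun b hb => hg b (by simp [hb])) (by rw [hg a (by simp), h2]) h3

/-- If `e'` occurred in `q`, then `q` would pass through the end of `p`, and up to there it is
shorter than `p` or ends with `e'`, unlike `p`. -/
theorem notMem_of_treeLike {d : ℕ} (ht : TreeLike g e d) (hp : p.length = d)
    (hpx : IsDirectedPath g e (e' :: p) x) (hq : q.length ≤ d) (hqy : IsDirectedPath g e q y) :
    e' ∉ q := by
  intro hmem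
  obtain ⟨a, ha, hne, hax⟩ := hpx.cons_inv
  obtain ⟨l, r, rfl⟩ := List.append_of_mem hmem
  obtain ⟨b, hb⟩ := hqy.of_append
  obtain ⟨c, hc, -, hcb⟩ := hb.cons_inv
  simp only [List.length_append, List.length_cons] at hq
  have : c = a ∨ b = a := by
    rcases hax with ⟨rfl, -⟩ | ⟨rfl, -⟩ <;> rcases hcb with ⟨rfl, rfl⟩ | ⟨rfl, rfl⟩ <;> simp
  rcases this with rfl | rfl
  · have := ht _ _ _ hp.le (by omega) ha hc
    subst this
    omega
  · have := ht _ _ _ hp.le (by simp; omega) ha hb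
    subst this
    simp at hne

end IsDirectedPath

section Ball

variable {n m dv dc : ℕ}

/-- The node `x` is the end of a directed path of length at most `d` that starts at `e`. -/
def InBall (g : FactorGraph n dv m dc) (e : Fin n × Fin dv) (d : ℕ) (x : Fin n ⊕ Fin m) : Prop :=
  ∃ p : List (Fin n × Fin dv), p.length ≤ d ∧ IsDirectedPath g e p x

/-- A coincidence of two paths is caused by a single edge `a`: redirecting `a` to the right socket of
almost any edge `x`, and `x` to that of `a`, leaves the two endpoints of `a` near `e`. The edge is
the last one of a path of minimal length that ends where another path ends; by minimality it occurs
nowhere else in the two paths. -/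
theorem exists_edge_of_not_treeLike {g : FactorGraph n dv m dc} {e : Fin n × Fin dv} {d : ℕ}
    (h : ¬ TreeLike g e d) :
    ∃ (a : Fin n × Fin dv) (l : List (Fin n × Fin dv)), l.length ≤ 2 * d ∧
      ∀ x ∉ l, InBall ((Equiv.swap a x).trans g) e d (Sum.inl a.1) ∧
        InBall ((Equiv.swap a x).trans g) e d (Sum.inr (g a).1) := by
  classical
  obtain ⟨k, hk, hkd, hmin⟩ : ∃ k, ¬ TreeLike g e k ∧ k ≤ d ∧ ∀ j < k, TreeLike g e j := by
    have hex : ∃ k, ¬ TreeLike g e k := ⟨d, h⟩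
    exact ⟨Nat.find hex, Nat.find_spec hex, Nat.find_min' hex h,
      fun j hj => not_not.1 (Nat.find_min hex hj)⟩
  -- Two paths with the same end; at the least depth `k` of failure one of them has length `k`.
  obtain ⟨p, q, x, hpk, hqk, hp, hq, hpq⟩ : ∃ (p q : List (Fin n × Fin dv))
      (x : Fin n ⊕ Fin m), p.length = k ∧ q.length ≤ k ∧ IsDirectedPath g e p x ∧
      IsDirectedPath g e q x ∧ p ≠ q := by
    simp only [TreeLike, not_forall] at hk
    obtain ⟨p, q, x, hpk, hqk, hp, hq, hpq⟩ := hk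
    by_cases h1 : p.length = k
    · exact ⟨p, q, x, h1, hqk, hp, hq, hpq⟩
    by_cases h2 : q.length = k
    · exact ⟨q, p, x, h2, hpk, hq, hp, Ne.symm hpq⟩
    · exact absurd (hmin (k - 1) (by omega) p q x (by omega) (by omega) hp hq) hpq
  rcases p with _ | ⟨a, p⟩
  · simp only [List.length_nil] at hpk
    exact absurd (List.length_eq_zero_iff.1 (by omega)).symm hpq
  simp only [List.length_cons] at hpk
  have ht : TreeLike g e p.length := hmin _ (by omega)
  have hap : a ∉ p := by
    obtain ⟨y, hy, -⟩ := hp.cons_inv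
    exact hp.notMem_of_treeLike ht rfl le_rfl hy
  have haq : a ∉ q := by
    by_cases hql : q.length ≤ p.length
    · exact hp.notMem_of_treeLike ht rfl hql hq
    rcases q with _ | ⟨b, q⟩
    · simp at hql
    simp only [List.length_cons] at hqk
    obtain ⟨y, hy, -, hyx⟩ := hp.cons_inv
    obtain ⟨z, hz, -, hzx⟩ := hq.cons_inv
    have h1 := hp.notMem_of_treeLike ht rfl (by omega) hz
    rw [List.mem_cons, not_or]
    refine ⟨?_, h1⟩
    rintro rfl
    have : z = y := by
      rcases hyx with ⟨rfl, rfl⟩ | ⟨rfl, rfl⟩ <;> simpa using hzx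
    subst this
    exact hpq (by rw [ht p q z le_rfl (by omega) hy hz])
  refine ⟨a, p ++ q, by simp only [List.length_append]; omega, fun b hb => ?_⟩
  simp only [List.mem_append, not_or] at hb
  have hsw : ∀ l : List (Fin n × Fin dv), a ∉ l → b ∉ l →
      ∀ c ∈ l, (Equiv.swap a b).trans g c = g c := fun l ha hb c hc => by
    rw [Equiv.trans_apply, Equiv.swap_apply_of_ne_of_ne]
    · rintro rfl; exact ha hc
    · rintro rfl; exact hb hc
  obtain ⟨y, hy, -, hyx⟩ := hp.cons_inv
  have h1 : InBall ((Equiv.swap a b).trans g) e d y :=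
    ⟨p, by omega, hy.congr (hsw p hap hb.1)⟩
  have h2 : InBall ((Equiv.swap a b).trans g) e d x :=
    ⟨q, by omega, hq.congr (hsw q haq hb.2)⟩
  rcases hyx with ⟨rfl, rfl⟩ | ⟨rfl, rfl⟩
  · exact ⟨h1, h2⟩
  · exact ⟨h2, h1⟩

open Classical in
theorem card_inBall_le (g : FactorGraph n dv m dc) (e : Fin n × Fin dv) (d : ℕ) :
    (Finset.univ.filter (InBall g e d)).card ≤ (1 + dv + dc) ^ d := by
  induction d with
  | zero =>
    refine Finset.card_le_one.2 fun x hx y hy => ?_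
    have : ∀ x, InBall g e 0 x → x = Sum.inl e.1 := by
      rintro x ⟨p, hp, h⟩
      obtain rfl := List.length_eq_zero_iff.1 (Nat.le_zero.1 hp)
      cases h
      rfl
    rw [this x (by simpa using hx), this y (by simpa using hy)]
  | succ d ih =>
    set S := Finset.univ.filter (InBall g e d)
    let nb : Fin n ⊕ Fin m → Finset (Fin n ⊕ Fin m) := fun x =>
      insert x (x.elim (fun i => Finset.univ.image fun k : Fin dv => Sum.inr (g (i, k)).1)
        (fun j => Finset.univ.image fun k : Fin dc => Sum.inl (g.symm (j, k)).1))
    have hnb : ∀ x, (nb x).card ≤ 1 + dv + dc := fun x => by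
      refine (Finset.card_insert_le _ _).trans ?_
      rcases x with i | j
      · have := Finset.card_image_le (s := Finset.univ)
          (f := fun k : Fin dv => (Sum.inr (g (i, k)).1 : Fin n ⊕ Fin m))
        simp only [Finset.card_univ, Fintype.card_fin, Sum.elim_inl] at this ⊢
        omega
      · have := Finset.card_image_le (s := Finset.univ)
          (f := fun k : Fin dc => (Sum.inl (g.symm (j, k)).1 : Fin n ⊕ Fin m))
        simp only [Finset.card_univ, Fintype.card_fin, Sum.elim_inr] at this ⊢
        omega
    have hsub : Finset.univ.filter (InBall g e (d + 1)) ⊆ S.biUnion nb := by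
      intro x hx
      obtain ⟨p, hp, h⟩ := (Finset.mem_filter.1 hx).2
      rw [Finset.mem_biUnion]
      by_cases hpd : p.length ≤ d
      · exact ⟨x, by simpa [S] using ⟨p, hpd, h⟩, by simp [nb]⟩
      rcases p with _ | ⟨a, p⟩
      · simp at hpd
      obtain ⟨y, hy, -, hyx⟩ := h.cons_inv
      refine ⟨y, by simpa [S] using ⟨p, by simpa using hp, hy⟩, ?_⟩
      rcases hyx with ⟨rfl, rfl⟩ | ⟨rfl, rfl⟩
      · simp only [nb, Sum.elim_inl, Finset.mem_insert, Finset.mem_image, Finset.mem_univ, true_and]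
        exact Or.inr ⟨a.2, rfl⟩
      · simp only [nb, Sum.elim_inr, Finset.mem_insert, Finset.mem_image, Finset.mem_univ, true_and]
        exact Or.inr ⟨(g a).2, by simp⟩
    calc _ ≤ (S.biUnion nb).card := Finset.card_le_card hsub
      _ ≤ S.card * (1 + dv + dc) := Finset.card_biUnion_le_card_mul _ _ _ fun x _ => hnb x
      _ ≤ (1 + dv + dc) ^ d * (1 + dv + dc) := Nat.mul_le_mul_right _ ih
      _ = _ := (pow_succ _ _).symm

open Classical in
/-- The second edge is counted by its right end, since this is the end that is near `e` after a
switch. -/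
theorem card_edge_inBall_le (g : FactorGraph n dv m dc) (e : Fin n × Fin dv) (d : ℕ) :
    (Finset.univ.filter fun ab : (Fin n × Fin dv) × (Fin n × Fin dv) =>
      InBall g e d (Sum.inl ab.1.1) ∧ InBall g e d (Sum.inr (g ab.2).1)).card ≤
      ((1 + dv + dc) ^ d) ^ 2 * (dv * dc) := by
  set S := Finset.univ.filter (InBall g e d) with hS
  have : ((S ×ˢ S) ×ˢ (Finset.univ : Finset (Fin dv × Fin dc))).card ≤
      ((1 + dv + dc) ^ d) ^ 2 * (dv * dc) := by
    rw [Finset.card_product, Finset.card_product, sq]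
    have := card_inBall_le g e d
    simp only [Finset.card_univ, Fintype.card_prod, Fintype.card_fin]
    gcongr
  refine le_trans (Finset.card_le_card_of_injOn
    (fun ab => ((Sum.inl ab.1.1, Sum.inr (g ab.2).1), (ab.1.2, (g ab.2).2))) ?_ ?_) this
  · intro ab hab
    simpa [hS] using hab
  · rintro ⟨a, b⟩ - ⟨a', b'⟩ - h
    simp only [Prod.mk.injEq, Sum.inl.injEq, Sum.inr.injEq] at h
    rw [Prod.mk.injEq]
    exact ⟨Prod.ext h.1.1 h.2.1, g.injective (Prod.ext h.1.2 h.2.2)⟩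

open Classical in
/-- Double counting of switches: from a graph whose neighborhood of `e` is not tree-like, at least
`n * dv - 2 * d` switches of the edge `exists_edge_of_not_treeLike` lead to graphs in which both
switched edges are among the few counted by `card_edge_inBall_le`; these two edges determine the
original graph. -/
theorem card_not_treeLike_mul_le (e : Fin n × Fin dv) (d : ℕ) :
    (Finset.univ.filter fun g : FactorGraph n dv m dc => ¬ TreeLike g e d).card *
        (n * dv - 2 * d) ≤
      Fintype.card (FactorGraph n dv m dc) * (((1 + dv + dc) ^ d) ^ 2 * (dv * dc)) := by
  set bad := Finset.univ.filter fun g : FactorGraph n dv m dc => ¬ TreeLike g e d with hbad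
  have hex : ∀ g : FactorGraph n dv m dc, ∃ (a : Fin n × Fin dv) (l : List (Fin n × Fin dv)),
      g ∈ bad → l.length ≤ 2 * d ∧
      ∀ x ∉ l, InBall ((Equiv.swap a x).trans g) e d (Sum.inl a.1) ∧
        InBall ((Equiv.swap a x).trans g) e d (Sum.inr (g a).1) := fun g => by
    by_cases hg : g ∈ bad
    · obtain ⟨a, l, h⟩ := exists_edge_of_not_treeLike (by simpa [hbad] using hg)
      exact ⟨a, l, fun _ => h⟩
    · exact ⟨e, [], fun h => absurd h hg⟩
  choose a l hal using hex
  let src : Finset (Σ _ : FactorGraph n dv m dc, Fin n × Fin dv) :=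
    bad.sigma fun g => Finset.univ.filter fun x => x ∉ l g
  let tgt : Finset (Σ _ : FactorGraph n dv m dc, (Fin n × Fin dv) × (Fin n × Fin dv)) :=
    Finset.univ.sigma fun g => Finset.univ.filter fun ab =>
      InBall g e d (Sum.inl ab.1.1) ∧ InBall g e d (Sum.inr (g ab.2).1)
  have h1 : bad.card * (n * dv - 2 * d) ≤ src.card := by
    rw [Finset.card_sigma, ← smul_eq_mul]
    refine Finset.card_nsmul_le_sum _ _ _ fun g hg => ?_
    have h2 : (Finset.univ.filter fun x => x ∉ l g) = (l g).toFinsetᶜ := by ext; simp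
    rw [h2, Finset.card_compl]
    have := List.toFinset_card_le (l g)
    have := (hal g hg).1
    simp only [Fintype.card_prod, Fintype.card_fin]
    omega
  have h2 : tgt.card ≤
      Fintype.card (FactorGraph n dv m dc) * (((1 + dv + dc) ^ d) ^ 2 * (dv * dc)) := by
    rw [Finset.card_sigma, ← smul_eq_mul, ← Finset.card_univ]
    exact Finset.sum_le_card_nsmul _ _ _ fun g _ => card_edge_inBall_le g e d
  refine h1.trans (le_trans (Finset.card_le_card_of_injOn
    (fun gx => ⟨(Equiv.swap (a gx.1) gx.2).trans gx.1, (a gx.1, gx.2)⟩) ?_ ?_) h2)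
  · rintro ⟨g, x⟩ hgx
    simp only [src, Finset.coe_sigma, Set.mem_sigma_iff, Finset.mem_coe, Finset.mem_filter,
      Finset.mem_univ, true_and] at hgx
    have := (hal g hgx.1).2 x hgx.2
    simpa [tgt] using this
  · rintro ⟨g, x⟩ - ⟨g', x'⟩ - h
    simp only [Sigma.mk.injEq, heq_eq_eq, Prod.mk.injEq] at h
    obtain ⟨h3, h4, rfl⟩ := h
    rw [← h4] at h3
    have : g = g' := by
      ext1 z
      have := DFunLike.congr_fun h3 (Equiv.swap (a g) x z)
      simpa using this
    rw [this]

end Ball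

/-! ### Messages on the computation tree -/

theorem measurePreserving_pi_precomp {ι κ X : Type*} [Fintype ι] [Fintype κ] [MeasurableSpace X]
    (μ : Measure X) [IsProbabilityMeasure μ] {φ : κ → ι} (hφ : Function.Injective φ) :
    MeasurePreserving (fun (x : ι → X) k => x (φ k)) (Measure.pi fun _ => μ)
      (Measure.pi fun _ => μ) := by
  refine ⟨by fun_prop, ?_⟩
  have h := (iIndepFun_pi (μ := fun _ : ι => μ) (X := fun _ x => x)
    fun _ => aemeasurable_id).precomp hφ
  rw [iIndepFun_iff_map_fun_eq_pi_map fun k => (measurable_pi_apply _).aemeasurable] at h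
  rw [h]
  congr 1
  ext1 k
  exact (measurePreserving_eval (fun _ : ι => μ) (φ k)).map_eq

theorem otherSocket_ne {d : ℕ} (j : Fin d) (i : Fin (d - 1)) : otherSocket j i ≠ j := by
  unfold otherSocket
  split_ifs with h <;> simp only [ne_eq, Fin.ext_iff] <;> omega

theorem otherSocket_injective {d : ℕ} (j : Fin d) : Function.Injective (otherSocket j) := by
  intro a b h
  unfold otherSocket at h
  split_ifs at h <;> simp only [Fin.ext_iff] at h ⊢ <;> omega

section Words

variable {n m dv dc : ℕ}

/-- One step down the computation tree: the choice of one of the other edges of a variable node, and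
then of one of the other edges of the check node reached. -/
abbrev Letter (dv dc : ℕ) : Type := Fin (dv - 1) × Fin (dc - 1)

/-- The `k`-th of the other edges at the variable node of `e`. -/
def outEdge (e : Fin n × Fin dv) (k : Fin (dv - 1)) : Fin n × Fin dv :=
  (e.1, otherSocket e.2 k)

/-- The edge reached from `e` by the step `a`. Its message of iteration `t` enters the message of
`e` of iteration `t + 1`. -/
def childEdge (g : FactorGraph n dv m dc) (e : Fin n × Fin dv) (a : Letter dv dc) :
    Fin n × Fin dv :=
  g.symm ((g (outEdge e a.1)).1, otherSocket (g (outEdge e a.1)).2 a.2)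

/-- The edge reached from `e` by a word of steps; the head of the list is the last step. -/
def wordEdge (g : FactorGraph n dv m dc) (e : Fin n × Fin dv) :
    List (Letter dv dc) → Fin n × Fin dv
  | [] => e
  | a :: l => childEdge g (wordEdge g e l) a

/-- The directed path along which a word leads from `e` to `wordEdge g e l`, last edge first. -/
def wordPath (g : FactorGraph n dv m dc) (e : Fin n × Fin dv) :
    List (Letter dv dc) → List (Fin n × Fin dv)
  | [] => []
  | a :: l => wordEdge g e (a :: l) :: outEdge (wordEdge g e l) a.1 :: wordPath g e l

theorem length_wordPath (g : FactorGraph n dv m dc) (e : Fin n × Fin dv)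
    (l : List (Letter dv dc)) : (wordPath g e l).length = 2 * l.length := by
  induction l with
  | nil => rfl
  | cons a l ih => simp only [wordPath, List.length_cons, ih]; ring

theorem headD_wordPath (g : FactorGraph n dv m dc) (e : Fin n × Fin dv)
    (l : List (Letter dv dc)) : (wordPath g e l).headD e = wordEdge g e l := by
  cases l <;> rfl

theorem outEdge_ne (e : Fin n × Fin dv) (k : Fin (dv - 1)) : outEdge e k ≠ e := fun h =>
  otherSocket_ne e.2 k (congrArg Prod.snd h)

theorem outEdge_injective (e : Fin n × Fin dv) : Function.Injective (outEdge e) := fun _ _ h =>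
  otherSocket_injective e.2 (congrArg Prod.snd h)

theorem isDirectedPath_outEdge {g : FactorGraph n dv m dc} {e : Fin n × Fin dv}
    {l : List (Letter dv dc)}
    (h : IsDirectedPath g e (wordPath g e l) (Sum.inl (wordEdge g e l).1)) (k : Fin (dv - 1)) :
    IsDirectedPath g e (outEdge (wordEdge g e l) k :: wordPath g e l)
      (Sum.inr (g (outEdge (wordEdge g e l) k)).1) :=
  .toCheck _ h rfl (by rw [headD_wordPath]; exact outEdge_ne _ _)

theorem isDirectedPath_wordPath (g : FactorGraph n dv m dc) (e : Fin n × Fin dv)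
    (l : List (Letter dv dc)) :
    IsDirectedPath g e (wordPath g e l) (Sum.inl (wordEdge g e l).1) := by
  induction l with
  | nil => exact .nil
  | cons a l ih =>
    refine .toVar _ (isDirectedPath_outEdge ih a.1) (by simp [wordEdge, childEdge]) ?_
    intro h
    have := congrArg g h
    simp only [wordEdge, childEdge, Equiv.apply_symm_apply, List.headD_cons] at this
    exact otherSocket_ne _ _ (congrArg Prod.snd this)

theorem wordPath_injective (g : FactorGraph n dv m dc) (e : Fin n × Fin dv) :
    Function.Injective (wordPath g e) := by
  intro l
  induction l with
  | nil =>
    intro l' h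
    cases l' with
    | nil => rfl
    | cons => simp [wordPath] at h
  | cons a l ih =>
    intro l' h
    cases l' with
    | nil => simp [wordPath] at h
    | cons b l' =>
      simp only [wordPath, List.cons.injEq] at h
      obtain ⟨h1, h2, h3⟩ := h
      obtain rfl := ih h3
      have h4 : a.1 = b.1 := outEdge_injective _ h2
      have h5 : a.2 = b.2 := by
        have := g.symm.injective h1
        rw [h4] at this
        exact otherSocket_injective _ (congrArg Prod.snd this)
      rw [Prod.ext h4 h5]

/-- The variable nodes of the computation tree of depth `2 * ℓ`. -/
abbrev VarWord (dv dc ℓ : ℕ) : Type := {l : List (Letter dv dc) // l.length ≤ ℓ}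

/-- The check nodes of the computation tree of depth `2 * ℓ`: the variable node above, and the edge
that leads down from it. -/
abbrev CheckWord (dv dc ℓ : ℕ) : Type := {l : List (Letter dv dc) // l.length < ℓ} × Fin (dv - 1)

instance (dv dc ℓ : ℕ) : Fintype (VarWord dv dc ℓ) :=
  (List.finite_length_le (Letter dv dc) ℓ).fintype

instance (dv dc ℓ : ℕ) : Fintype {l : List (Letter dv dc) // l.length < ℓ} :=
  (List.finite_length_lt (Letter dv dc) ℓ).fintype

theorem injective_varWord {g : FactorGraph n dv m dc} {e : Fin n × Fin dv} {ℓ : ℕ}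
    (h : TreeLike g e (2 * ℓ)) :
    Function.Injective fun l : VarWord dv dc ℓ => (wordEdge g e l.1).1 := by
  rintro ⟨l, hl⟩ ⟨l', hl'⟩ hll
  have h1 := isDirectedPath_wordPath g e l
  have h2 := isDirectedPath_wordPath g e l'
  simp only at hll
  rw [← hll] at h2
  have := h _ _ _ (by rw [length_wordPath]; omega) (by rw [length_wordPath]; omega) h1 h2
  exact Subtype.ext (wordPath_injective g e this)

theorem injective_checkWord {g : FactorGraph n dv m dc} {e : Fin n × Fin dv} {ℓ : ℕ}
    (h : TreeLike g e (2 * ℓ)) :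
    Function.Injective fun lk : CheckWord dv dc ℓ => (g (outEdge (wordEdge g e lk.1.1) lk.2)).1 := by
  rintro ⟨⟨l, hl⟩, k⟩ ⟨⟨l', hl'⟩, k'⟩ hll
  have h1 := isDirectedPath_outEdge (isDirectedPath_wordPath g e l) k
  have h2 := isDirectedPath_outEdge (isDirectedPath_wordPath g e l') k'
  simp only at hll
  rw [← hll] at h2
  have := h _ _ _ (by rw [List.length_cons, length_wordPath]; omega)
    (by rw [List.length_cons, length_wordPath]; omega) h1 h2
  simp only [List.cons.injEq] at this
  obtain rfl := wordPath_injective g e this.2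
  obtain rfl := outEdge_injective _ this.1
  rfl

end Words

/-- Channel outputs, and the noises of variable nodes, variable-to-check wires, check nodes and
check-to-variable wires, for arbitrary index types `V`, `C`, `W`, `W'` of variable nodes, check
nodes and wires in the two directions. It covers both a factor graph and a computation tree. -/
abbrev NoiseSpace (V C W W' Y M U : Type*) (ℓ : ℕ) : Type _ :=
  (V → Y) × (Fin (ℓ + 1) → V → U) × (Fin (ℓ + 1) → W → M) × (Fin ℓ → C → U) × (Fin ℓ → W' → M)

namespace NoisySystem

variable {dv dc : ℕ} {Y M U : Type*} [MeasurableSpace Y] [MeasurableSpace M] [MeasurableSpace U]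

/-- The product law of the channel outputs (for the input `+1`) and all noises. -/
def noiseLaw (D : NoisySystem dv dc Y M U) (V C W W' : Type*) [Fintype V] [Fintype C] [Fintype W]
    [Fintype W'] (ℓ : ℕ) : Measure (NoiseSpace V C W W' Y M U ℓ) :=
  (Measure.pi fun _ : V => (D.channel 1 : Measure Y)).prod <|
  (Measure.pi fun t : Fin (ℓ + 1) => Measure.pi fun _ : V => (D.varNoise t : Measure U)).prod <|
  (Measure.pi fun t : Fin (ℓ + 1) => Measure.pi fun _ : W =>
    (D.wireNoiseVC t : Measure M)).prod <|
  (Measure.pi fun t : Fin ℓ => Measure.pi fun _ : C =>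
    (D.checkNoise (t + 1) : Measure U)).prod <|
  (Measure.pi fun t : Fin ℓ => Measure.pi fun _ : W' => (D.wireNoiseCV (t + 1) : Measure M))

instance (D : NoisySystem dv dc Y M U) (V C W W' : Type*) [Fintype V] [Fintype C] [Fintype W]
    [Fintype W'] (ℓ : ℕ) : IsProbabilityMeasure (D.noiseLaw V C W W' ℓ) := by
  unfold noiseLaw; infer_instance

theorem law_eq (D : NoisySystem dv dc Y M U) (n m ℓ : ℕ) :
    D.law n m ℓ = (uniformOn (Set.univ : Set (FactorGraph n dv m dc))).prod
      (D.noiseLaw (Fin n) (Fin m) (Fin n × Fin dv) (Fin n × Fin dv) ℓ) := rfl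

/-- Restriction of the noise along maps of the index types. -/
def reindex {V V₁ C C₁ W W₁ W' W₁' : Type*} {ℓ : ℕ} (φ : V₁ → V) (χ : C₁ → C) (ψ : W₁ → W)
    (ψ' : W₁' → W') (ω : NoiseSpace V C W W' Y M U ℓ) : NoiseSpace V₁ C₁ W₁ W₁' Y M U ℓ :=
  (fun i => ω.1 (φ i), fun t i => ω.2.1 t (φ i), fun t i => ω.2.2.1 t (ψ i),
    fun t i => ω.2.2.2.1 t (χ i), fun t i => ω.2.2.2.2 t (ψ' i))

theorem measurable_reindex {V V₁ C C₁ W W₁ W' W₁' : Type*} {ℓ : ℕ} (φ : V₁ → V) (χ : C₁ → C)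
    (ψ : W₁ → W) (ψ' : W₁' → W') :
    Measurable (reindex φ χ ψ ψ' : NoiseSpace V C W W' Y M U ℓ → _) := by
  unfold reindex; fun_prop

theorem measurePreserving_reindex (D : NoisySystem dv dc Y M U)
    {V V₁ C C₁ W W₁ W' W₁' : Type*} [Fintype V] [Fintype C] [Fintype W]
    [Fintype W'] [Fintype V₁] [Fintype C₁] [Fintype W₁] [Fintype W₁'] {ℓ : ℕ} {φ : V₁ → V}
    {χ : C₁ → C} {ψ : W₁ → W} {ψ' : W₁' → W'} (hφ : Function.Injective φ)
    (hχ : Function.Injective χ) (hψ : Function.Injective ψ) (hψ' : Function.Injective ψ') :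
    MeasurePreserving (reindex φ χ ψ ψ') (D.noiseLaw V C W W' ℓ)
      (D.noiseLaw V₁ C₁ W₁ W₁' ℓ) :=
  (measurePreserving_pi_precomp _ hφ).prod <|
  (measurePreserving_pi _ _ fun _ => measurePreserving_pi_precomp _ hφ).prod <|
  (measurePreserving_pi _ _ fun _ => measurePreserving_pi_precomp _ hψ).prod <|
  (measurePreserving_pi _ _ fun _ => measurePreserving_pi_precomp _ hχ).prod <|
  (measurePreserving_pi _ _ fun _ => measurePreserving_pi_precomp _ hψ')

/-- Noise on the computation tree; a wire that leads up is indexed by the node it leaves. -/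
abbrev TreeNoise (dv dc : ℕ) (Y M U : Type*) (ℓ : ℕ) : Type _ :=
  NoiseSpace (VarWord dv dc ℓ) (CheckWord dv dc ℓ) (VarWord dv dc ℓ) (CheckWord dv dc ℓ) Y M U ℓ

/-- The message that the node `l` of the computation tree sends up in iteration `t`, as received. -/
def treeMessage (D : NoisySystem dv dc Y M U) {ℓ : ℕ} (ω : TreeNoise dv dc Y M U ℓ) :
    (t : ℕ) → (l : List (Letter dv dc)) → l.length + t ≤ ℓ → M
  | 0, l, h => D.wire (D.varInit (ω.1 ⟨l, h⟩) (ω.2.1 0 ⟨l, h⟩)) (ω.2.2.1 0 ⟨l, h⟩)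
  | t + 1, l, h =>
      D.wire (D.varMap (t + 1) (ω.1 ⟨l, by omega⟩)
        (fun k => D.wire (D.checkMap (t + 1)
            (fun k' => D.treeMessage ω t ((k, k') :: l) (by rw [List.length_cons]; omega))
            (ω.2.2.2.1 ⟨t, by omega⟩ (⟨l, by omega⟩, k)))
          (ω.2.2.2.2 ⟨t, by omega⟩ (⟨l, by omega⟩, k)))
        (ω.2.1 ⟨t + 1, by omega⟩ ⟨l, by omega⟩))
      (ω.2.2.1 ⟨t + 1, by omega⟩ ⟨l, by omega⟩)

theorem measurable_treeMessage (D : NoisySystem dv dc Y M U) {ℓ : ℕ} :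
    ∀ (t : ℕ) (l : List (Letter dv dc)) (h : l.length + t ≤ ℓ),
      Measurable fun ω : TreeNoise dv dc Y M U ℓ => D.treeMessage ω t l h
  | 0, l, h => by
      unfold treeMessage
      refine D.measurable_wire.comp (Measurable.prodMk (D.measurable_varInit.comp
        (Measurable.prodMk ?_ ?_)) ?_) <;> fun_prop
  | t + 1, l, h => by
      unfold treeMessage
      refine D.measurable_wire.comp (Measurable.prodMk ((D.measurable_varMap (t + 1)).comp
        (Measurable.prodMk ?_ (Measurable.prodMk ?_ ?_))) ?_)
      · fun_prop
      · refine measurable_pi_lambda _ fun k => D.measurable_wire.comp (Measurable.prodMk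
          ((D.measurable_checkMap (t + 1)).comp (Measurable.prodMk ?_ ?_)) ?_)
        · exact measurable_pi_lambda _ fun k' => measurable_treeMessage D t _ _
        · fun_prop
        · fun_prop
      · fun_prop
      · fun_prop

/-- The noise of a factor graph, read along the computation tree of `e`. If the neighborhood of `e`
is not tree-like, the same variable is read several times. -/
def toTree {n m : ℕ} (g : FactorGraph n dv m dc) (e : Fin n × Fin dv) (ℓ : ℕ) :
    NoiseSpace (Fin n) (Fin m) (Fin n × Fin dv) (Fin n × Fin dv) Y M U ℓ →
      TreeNoise dv dc Y M U ℓ :=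
  reindex (fun l => (wordEdge g e l.1).1) (fun lk => (g (outEdge (wordEdge g e lk.1.1) lk.2)).1)
    (fun l => wordEdge g e l.1) (fun lk => outEdge (wordEdge g e lk.1.1) lk.2)

/-- No tree-likeness is needed here: it matters for the law of `toTree g e ℓ ω` only. -/
theorem received_wordEdge {n m ℓ : ℕ} (D : NoisySystem dv dc Y M U) (g : FactorGraph n dv m dc)
    (e : Fin n × Fin dv)
    (ω : NoiseSpace (Fin n) (Fin m) (Fin n × Fin dv) (Fin n × Fin dv) Y M U ℓ) :
    ∀ (t : ℕ) (l : List (Letter dv dc)) (h : l.length + t ≤ ℓ),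
      D.received g ω.1 ω.2.1 ω.2.2.1 ω.2.2.2.1 ω.2.2.2.2 t (by omega) (wordEdge g e l) =
        D.treeMessage (toTree g e ℓ ω) t l h
  | 0, l, h => rfl
  | t + 1, l, h => by
      unfold treeMessage
      simp only [← received_wordEdge D g e ω t]
      rfl

theorem message_eq_treeMessage {n m ℓ : ℕ} (D : NoisySystem dv dc Y M U)
    (e : Fin n × Fin dv) (ω : SampleSpace n dv m dc Y M U ℓ) :
    D.message e ω = D.treeMessage (toTree ω.1 e ℓ ω.2) ℓ [] (by simp) :=
  received_wordEdge D ω.1 e ω.2 ℓ [] (by simp)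

theorem measurable_message {n m ℓ : ℕ} (D : NoisySystem dv dc Y M U) (e : Fin n × Fin dv) :
    Measurable (D.message e : SampleSpace n dv m dc Y M U ℓ → M) := by
  refine measurable_from_prod_countable_right fun g => ?_
  simp only [message_eq_treeMessage]
  exact (D.measurable_treeMessage ℓ [] (by simp)).comp (measurable_reindex _ _ _ _)

theorem measurableSet_incorrect (D : NoisySystem dv dc Y M U) : MeasurableSet D.incorrect :=
  (D.measurable_belief measurableSet_Ioi).compl

/-- The probability that the message of the root of the computation tree in iteration `ℓ` is
incorrect, when all noises in the tree are independent. -/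
def treeError (D : NoisySystem dv dc Y M U) (ℓ : ℕ) : ℝ :=
  (D.noiseLaw (VarWord dv dc ℓ) (CheckWord dv dc ℓ) (VarWord dv dc ℓ) (CheckWord dv dc ℓ) ℓ).real
    {ω | D.treeMessage ω ℓ [] (by simp) ∈ D.incorrect}

/-- In a tree-like neighborhood the nodes of the computation tree are distinct nodes of the graph, so
the noise read along the tree is independent. -/
theorem measureReal_incorrect_of_treeLike {n m ℓ : ℕ} (D : NoisySystem dv dc Y M U)
    {g : FactorGraph n dv m dc} {e : Fin n × Fin dv} (h : TreeLike g e (2 * ℓ)) :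
    (D.noiseLaw (Fin n) (Fin m) (Fin n × Fin dv) (Fin n × Fin dv) ℓ).real
      {ω | D.message e (g, ω) ∈ D.incorrect} = D.treeError ℓ := by
  have hmp := D.measurePreserving_reindex (ℓ := ℓ) (injective_varWord h) (injective_checkWord h)
    (ψ := fun l : VarWord dv dc ℓ => wordEdge g e l.1)
    (ψ' := fun lk : CheckWord dv dc ℓ => outEdge (wordEdge g e lk.1.1) lk.2)
    (fun _ _ hl => injective_varWord h (congrArg Prod.fst hl))
    (fun _ _ hl => injective_checkWord h (congrArg (fun x => (g x).1) hl))
  have hms : MeasurableSet {ω : TreeNoise dv dc Y M U ℓ |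
      D.treeMessage ω ℓ [] (by simp) ∈ D.incorrect} :=
    (D.measurable_treeMessage ℓ [] (by simp)) D.measurableSet_incorrect
  rw [treeError, ← hmp.measureReal_preimage hms.nullMeasurableSet]
  simp only [message_eq_treeMessage]
  rfl

end NoisySystem

/-! ### Concentration under bounded differences -/

open scoped NNReal

/-- Bounded differences imply concentration: a bounded measurable function that changes by at most
`K` between points related by `R` is, after centering, sub-Gaussian with variance proxy
`c * K ^ 2`. The bound `C` on the function serves integrability only and does not enter the
conclusion. -/
def SubgaussianDiff {Ω : Type*} [MeasurableSpace Ω] (μ : Measure Ω) (R : Ω → Ω → Prop)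
    (c : ℝ≥0) : Prop :=
  ∀ (f : Ω → ℝ) (C : ℝ) (K : ℝ≥0), Measurable f → (∀ x, |f x| ≤ C) →
    (∀ x y, R x y → |f x - f y| ≤ K) →
    HasSubgaussianMGF (fun x => f x - ∫ y, f y ∂μ) (c * K ^ 2) μ

/-- Two pairs that differ in one component only, where they are related. -/
def ProdRel {Ω Ω' : Type*} (R : Ω → Ω → Prop) (S : Ω' → Ω' → Prop) (x y : Ω × Ω') : Prop :=
  (R x.1 y.1 ∧ x.2 = y.2) ∨ (x.1 = y.1 ∧ S x.2 y.2)

/-- Two families that differ at one index only, where they are related. -/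
def PiRel {ι Ω : Type*} (R : Ω → Ω → Prop) (x y : ι → Ω) : Prop :=
  ∃ i, R (x i) (y i) ∧ ∀ j, j ≠ i → x j = y j

namespace SubgaussianDiff

variable {Ω Ω' : Type*} [MeasurableSpace Ω] [MeasurableSpace Ω']

theorem mono {μ : Measure Ω} {R : Ω → Ω → Prop} {c c' : ℝ≥0} (h : SubgaussianDiff μ R c)
    (hc : c ≤ c') : SubgaussianDiff μ R c' := by
  intro f C K hf hC hK
  have h1 := h f C K hf hC hK
  refine ⟨h1.integrable_exp_mul, fun t => (h1.mgf_le t).trans ?_⟩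
  have : (c : ℝ) ≤ c' := hc
  push_cast
  gcongr

theorem of_map {μ : Measure Ω} {ν : Measure Ω'} {φ : Ω → Ω'} (hφ : MeasurePreserving φ μ ν)
    {R : Ω → Ω → Prop} {S : Ω' → Ω' → Prop} {c : ℝ≥0} (h : SubgaussianDiff μ R c)
    (hRS : ∀ x y, R x y → S (φ x) (φ y)) : SubgaussianDiff ν S c := by
  intro f C K hf hC hK
  have h1 := h (f ∘ φ) C K (hf.comp hφ.measurable) (fun x => hC _)
    fun x y hxy => hK _ _ (hRS x y hxy)
  have h2 : ∫ y, f y ∂ν = ∫ x, (f ∘ φ) x ∂μ := by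
    rw [← hφ.map_eq, integral_map hφ.measurable.aemeasurable hf.aestronglyMeasurable]; rfl
  rw [h2]
  set m := ∫ x, (f ∘ φ) x ∂μ
  have hm : Measurable fun x => f x - m := hf.sub_const m
  rw [← HasSubgaussianMGF.id_map_iff hm.aemeasurable, ← hφ.map_eq,
    Measure.map_map hm hφ.measurable,
    HasSubgaussianMGF.id_map_iff (hm.comp hφ.measurable).aemeasurable]
  exact h1

/-- Hoeffding's lemma. -/
theorem univ (μ : Measure Ω) [IsProbabilityMeasure μ] :
    SubgaussianDiff μ (fun _ _ => True) 1 := by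
  intro f C K hf hC hK
  have := nonempty_of_isProbabilityMeasure μ
  have hbdd : BddBelow (Set.range f) := ⟨-C, by rintro _ ⟨x, rfl⟩; exact (abs_le.1 (hC x)).1⟩
  set a := ⨅ x, f x
  have h1 : ∀ x, f x ∈ Set.Icc a (a + K) := by
    refine fun x => ⟨ciInf_le hbdd x, ?_⟩
    have : f x - K ≤ a := le_ciInf fun y => by
      have := (abs_le.1 (hK x y trivial)).2
      linarith
    linarith
  have h2 := hasSubgaussianMGF_of_mem_Icc (μ := μ) hf.aemeasurable (Filter.Eventually.of_forall h1)
  refine ⟨h2.integrable_exp_mul, fun t => (h2.mgf_le t).trans ?_⟩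
  push_cast
  gcongr
  simp only [add_sub_cancel_left, Real.norm_eq_abs, NNReal.abs_eq, one_mul]
  have : (0 : ℝ) ≤ K := K.2
  nlinarith

/-- Any two points are related through `x₀`, so the oscillation is at most `2 * K`. -/
theorem star (μ : Measure Ω) [IsProbabilityMeasure μ] (x₀ : Ω) :
    SubgaussianDiff μ (fun x _ => x = x₀) 4 := by
  intro f C K hf hC hK
  have h := univ μ f C (2 * K) hf hC fun x y _ => by
    have h1 := abs_le.1 (hK x₀ x rfl)
    have h2 := abs_le.1 (hK x₀ y rfl)
    push_cast
    exact abs_le.2 ⟨by linarith, by linarith⟩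
  convert h using 1
  ring

/-- Tensorization: for fixed second component the function is sub-Gaussian about its partial mean,
and the partial mean inherits the bounded differences in the second component. -/
theorem prod {μ : Measure Ω} {ν : Measure Ω'} [IsProbabilityMeasure μ] [IsProbabilityMeasure ν]
    {R : Ω → Ω → Prop} {S : Ω' → Ω' → Prop} {a b : ℝ≥0} (hμ : SubgaussianDiff μ R a)
    (hν : SubgaussianDiff ν S b) : SubgaussianDiff (μ.prod ν) (ProdRel R S) (a + b) := by
  intro f C K hf hC hK
  have hfi : Integrable f (μ.prod ν) :=
    Integrable.of_bound hf.aestronglyMeasurable C (Filter.Eventually.of_forall hC)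
  have hfy : ∀ y, Measurable fun x => f (x, y) := fun y => by fun_prop
  have hfyi : ∀ y, Integrable (fun x => f (x, y)) μ := fun y =>
    Integrable.of_bound (hfy y).aestronglyMeasurable C (Filter.Eventually.of_forall fun x => hC _)
  set h : Ω' → ℝ := fun y => ∫ x, f (x, y) ∂μ with hh
  have hhm : Measurable h :=
    (StronglyMeasurable.integral_prod_left' (hf.stronglyMeasurable)).measurable
  have hhC : ∀ y, |h y| ≤ C := fun y => by
    have := norm_integral_le_of_norm_le_const (μ := μ) (f := fun x => f (x, y)) (C := C)
      (Filter.Eventually.of_forall fun x => hC _)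
    simpa using this
  have hhK : ∀ y y', S y y' → |h y - h y'| ≤ K := fun y y' hy => by
    rw [hh]
    simp only
    rw [← integral_sub (hfyi y) (hfyi y')]
    have := norm_integral_le_of_norm_le_const (μ := μ) (f := fun x => f (x, y) - f (x, y'))
      (C := K) (Filter.Eventually.of_forall fun x => hK (x, y) (x, y') (Or.inr ⟨rfl, hy⟩))
    simpa using this
  have hmean : ∫ z, f z ∂(μ.prod ν) = ∫ y, h y ∂ν := integral_prod_symm f hfi
  rw [hmean]
  set m := ∫ y, h y ∂ν
  have h1 := hν h C K hhm hhC hhK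
  have h2 := fun y => hμ (fun x => f (x, y)) C K (hfy y) (fun x => hC _)
    fun x x' hx => hK (x, y) (x', y) (Or.inl ⟨hx, rfl⟩)
  have hint : ∀ t : ℝ, Integrable (fun z => Real.exp (t * (f z - m))) (μ.prod ν) := fun t => by
    refine Integrable.of_bound (by fun_prop) (Real.exp (|t| * (C + |m|)))
      (Filter.Eventually.of_forall fun z => ?_)
    rw [Real.norm_eq_abs, Real.abs_exp, Real.exp_le_exp]
    calc t * (f z - m) ≤ |t * (f z - m)| := le_abs_self _
      _ = |t| * |f z - m| := abs_mul _ _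
      _ ≤ _ := by gcongr; exact (abs_sub _ _).trans (by gcongr; exact hC z)
  refine ⟨hint, fun t => ?_⟩
  have h3 : ∀ y, ∫ x, Real.exp (t * (f (x, y) - m)) ∂μ ≤
      Real.exp (a * K ^ 2 * t ^ 2 / 2) * Real.exp (t * (h y - m)) := fun y => by
    have h4 : ∀ x, Real.exp (t * (f (x, y) - m)) =
        Real.exp (t * (f (x, y) - h y)) * Real.exp (t * (h y - m)) := fun x => by
      rw [← Real.exp_add]; ring_nf
    simp_rw [h4]
    rw [integral_mul_const]
    gcongr
    exact (h2 y).mgf_le t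
  calc mgf (fun x => f x - m) (μ.prod ν) t
      = ∫ y, ∫ x, Real.exp (t * (f (x, y) - m)) ∂μ ∂ν := integral_prod_symm _ (hint t)
    _ ≤ ∫ y, Real.exp (a * K ^ 2 * t ^ 2 / 2) * Real.exp (t * (h y - m)) ∂ν :=
        integral_mono (hint t).integral_prod_right ((h1.integrable_exp_mul t).const_mul _) h3
    _ = Real.exp (a * K ^ 2 * t ^ 2 / 2) * mgf (fun y => h y - m) ν t := by
        rw [integral_const_mul]; rfl
    _ ≤ Real.exp (a * K ^ 2 * t ^ 2 / 2) * Real.exp (↑(b * K ^ 2) * t ^ 2 / 2) := by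
        gcongr; exact h1.mgf_le t
    _ = _ := by rw [← Real.exp_add]; push_cast; ring_nf

theorem pi_fin {R : Ω → Ω → Prop} {c : ℝ≥0} :
    ∀ {k : ℕ} (μ : Fin k → Measure Ω) [∀ i, IsProbabilityMeasure (μ i)],
      (∀ i, SubgaussianDiff (μ i) R c) → SubgaussianDiff (Measure.pi μ) (PiRel R) (k * c)
  | 0, μ, _, _ => by
      intro f C K hf hC hK
      have : ∀ x, f x - ∫ y, f y ∂Measure.pi μ = 0 := fun x => by
        have h : ∀ y, f y = f x := fun y => by rw [Subsingleton.elim y x]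
        simp [h]
      simp_rw [this]
      simp
  | k + 1, μ, _, h => by
      have ih := pi_fin (fun j : Fin k => μ (Fin.succAbove 0 j)) fun j => h _
      have hmp := (measurePreserving_piFinSuccAbove μ 0).symm
      have := of_map hmp ((h 0).prod ih) (S := PiRel R) ?_
      · refine this.mono (le_of_eq ?_)
        push_cast; ring
      · rintro ⟨x, xs⟩ ⟨y, ys⟩ (⟨h1, h2⟩ | ⟨h1, i, h2, h3⟩)
        · refine ⟨0, h1, fun j hj => ?_⟩
          obtain ⟨j, rfl⟩ := Fin.exists_succ_eq.2 hj
          exact congrFun h2 j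
        · refine ⟨i.succ, h2, fun j => ?_⟩
          refine Fin.cases (fun _ => h1) (fun j hj => ?_) j
          exact h3 j fun h => hj (by rw [h])

theorem pi {ι : Type*} [Fintype ι] {R : Ω → Ω → Prop} {c : ℝ≥0} (μ : ι → Measure Ω)
    [∀ i, IsProbabilityMeasure (μ i)] (h : ∀ i, SubgaussianDiff (μ i) R c) :
    SubgaussianDiff (Measure.pi μ) (PiRel R) (Fintype.card ι * c) := by
  have e := (Fintype.equivFin ι).symm
  have h1 := pi_fin (fun j => μ (e j)) fun j => h _
  refine of_map (measurePreserving_piCongrLeft μ e) h1 ?_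
  rintro x y ⟨i, h2, h3⟩
  refine ⟨e i, ?_, fun j hj => ?_⟩
  · simpa [MeasurableEquiv.coe_piCongrLeft] using h2
  · obtain ⟨j, rfl⟩ := e.surjective j
    simpa [MeasurableEquiv.coe_piCongrLeft] using h3 j fun h => hj (by rw [h])

end SubgaussianDiff

theorem measurePreserving_uniformOn_equiv {A B : Type*} [Fintype A] [Fintype B]
    [MeasurableSpace A] [MeasurableSpace B] [MeasurableSingletonClass A]
    [MeasurableSingletonClass B] (φ : A ≃ B) :
    MeasurePreserving φ (uniformOn Set.univ) (uniformOn Set.univ) := by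
  have hφ : Measurable φ := measurable_of_countable _
  refine ⟨hφ, Measure.ext_of_singleton fun b => ?_⟩
  rw [Measure.map_apply hφ (measurableSet_singleton b), uniformOn_univ, uniformOn_univ,
    Fintype.card_congr φ]
  have : φ ⁻¹' {b} = {φ.symm b} := by ext; simp [Equiv.eq_symm_apply]
  rw [this, Measure.count_singleton, Measure.count_singleton]

theorem uniformOn_univ_prod {A B : Type*} [Fintype A] [Fintype B] [Nonempty A] [Nonempty B]
    [MeasurableSpace A] [MeasurableSpace B] [MeasurableSingletonClass A]
    [MeasurableSingletonClass B] :
    (uniformOn (Set.univ : Set A)).prod (uniformOn (Set.univ : Set B)) =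
      uniformOn (Set.univ : Set (A × B)) := by
  have := isProbabilityMeasure_uniformOn (s := (Set.univ : Set B)) Set.finite_univ Set.univ_nonempty
  refine Measure.ext_of_singleton fun ⟨a, b⟩ => ?_
  rw [← Set.singleton_prod_singleton, Measure.prod_prod, uniformOn_univ, uniformOn_univ,
    Set.singleton_prod_singleton, uniformOn_univ]
  simp only [Measure.count_singleton, Fintype.card_prod, Nat.cast_mul, one_div]
  rw [ENNReal.mul_inv (by simp) (by simp)]

/-- Two bijections that differ by a switch: the values at `i` and `j` are exchanged. -/
def SwapRel {A B : Type*} [DecidableEq A] (σ τ : A ≃ B) : Prop :=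
  ∃ i j, τ = (Equiv.swap i j).trans σ

/-- A uniform permutation of `Fin (N + 1)` is a uniform permutation of the last `N` elements followed
by the transposition of `0` with an independent uniform point. Every choice of that point is one
switch away from the choice `0`, whence the use of `SubgaussianDiff.star`. -/
theorem subgaussianDiff_perm : ∀ (N : ℕ) [MeasurableSpace (Equiv.Perm (Fin N))]
    [MeasurableSingletonClass (Equiv.Perm (Fin N))],
    SubgaussianDiff (uniformOn (Set.univ : Set (Equiv.Perm (Fin N)))) SwapRel (4 * N)
  | 0, _, _ => by
      have := isProbabilityMeasure_uniformOn (s := (Set.univ : Set (Equiv.Perm (Fin 0))))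
        Set.finite_univ Set.univ_nonempty
      intro f C K hf hC hK
      have : ∀ x, f x - ∫ y, f y ∂(uniformOn (Set.univ : Set (Equiv.Perm (Fin 0)))) = 0 :=
        fun x => by
          have h : ∀ y, f y = f x := fun y => by rw [Subsingleton.elim y x]
          simp [h]
      simp_rw [this]
      simp
  | N + 1, _, _ => by
      let _ : MeasurableSpace (Equiv.Perm (Fin N)) := ⊤
      have := isProbabilityMeasure_uniformOn (s := (Set.univ : Set (Equiv.Perm (Fin N))))
        Set.finite_univ Set.univ_nonempty
      have := isProbabilityMeasure_uniformOn (s := (Set.univ : Set (Fin (N + 1))))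
        Set.finite_univ Set.univ_nonempty
      have h1 : ∀ p (e : Equiv.Perm (Fin N)), Equiv.Perm.decomposeFin.symm (p, e) =
          Equiv.swap 0 p * Equiv.Perm.decomposeFin.symm (0, e) := fun p e => by
        ext x
        refine Fin.cases ?_ (fun x => ?_) x <;> simp
      have h0 : ∀ p (e : Equiv.Perm (Fin N)), SwapRel (Equiv.Perm.decomposeFin.symm (0, e))
          (Equiv.Perm.decomposeFin.symm (p, e)) := fun p e => by
        rw [h1 p, Equiv.swap_mul_eq_mul_swap]
        exact ⟨_, _, rfl⟩
      have hmp := measurePreserving_uniformOn_equiv (Equiv.Perm.decomposeFin (n := N)).symm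
      rw [← uniformOn_univ_prod] at hmp
      refine (SubgaussianDiff.of_map hmp ((SubgaussianDiff.star _ 0).prod
        (subgaussianDiff_perm N)) ?_).mono (le_of_eq (by push_cast; ring))
      rintro ⟨p, e⟩ ⟨q, e'⟩ (⟨rfl, h⟩ | ⟨h, i, j, h'⟩)
      · obtain rfl : e = e' := h
        exact h0 q e
      · obtain rfl : p = q := h
        obtain rfl : e' = _ := h'
        refine ⟨i.succ, j.succ, ?_⟩
        ext x
        refine Fin.cases ?_ (fun x => ?_) x
        · simp [Equiv.swap_apply_of_ne_of_ne (Fin.succ_ne_zero i).symm (Fin.succ_ne_zero j).symm]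
        · simp [← (Fin.succ_injective N).map_swap]

theorem subgaussianDiff_equiv {A B : Type*} [Fintype A] [Fintype B] [DecidableEq A]
    [DecidableEq B] [MeasurableSpace (A ≃ B)]
    [MeasurableSingletonClass (A ≃ B)] (h : Fintype.card A = Fintype.card B) :
    SubgaussianDiff (uniformOn (Set.univ : Set (A ≃ B))) SwapRel (4 * Fintype.card A) := by
  let _ : MeasurableSpace (Equiv.Perm (Fin (Fintype.card A))) := ⊤
  let φ := Fintype.equivFin A
  let ψ := (Fintype.equivFin B).trans (finCongr h.symm)
  refine SubgaussianDiff.of_map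
    (measurePreserving_uniformOn_equiv (Equiv.equivCongr φ.symm ψ.symm))
    (subgaussianDiff_perm _) ?_
  rintro σ _ ⟨i, j, rfl⟩
  refine ⟨φ.symm i, φ.symm j, ?_⟩
  ext x
  simp [φ.injective.map_swap]

/-! ### Influence of a single change on the messages -/

section Hamming

theorem hammingDist_le_of_swapRel {A B : Type*} [Fintype A] [DecidableEq A] [DecidableEq B]
    {σ τ : A ≃ B} (h : SwapRel σ τ) : hammingDist (σ : A → B) τ ≤ 2 := by
  obtain ⟨i, j, rfl⟩ := h
  refine (Finset.card_le_card (t := {i, j}) fun x hx => ?_).trans Finset.card_le_two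
  by_contra hx'
  simp only [Finset.mem_insert, Finset.mem_singleton, not_or] at hx'
  simp [Equiv.swap_apply_of_ne_of_ne hx'.1 hx'.2] at hx

open Classical in
theorem hammingDist_le_of_piRel {ι Ω : Type*} [Fintype ι] {R : Ω → Ω → Prop} {x y : ι → Ω}
    (h : PiRel R x y) : hammingDist x y ≤ 2 := by
  obtain ⟨i, -, h⟩ := h
  refine (Finset.card_le_card (t := {i}) fun j hj => ?_).trans (by simp)
  by_contra hj'
  simp [h j (by simpa using hj')] at hj

open Classical in
theorem hammingDist_le_of_piRel_piRel {κ ι Ω : Type*} [Fintype ι] {R : Ω → Ω → Prop}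
    {x y : κ → ι → Ω} (h : PiRel (PiRel R) x y) (t : κ) : hammingDist (x t) (y t) ≤ 2 := by
  obtain ⟨i, hi, h⟩ := h
  by_cases ht : t = i
  · subst ht; exact hammingDist_le_of_piRel hi
  · simp [h t ht]

end Hamming

namespace NoisySystem

variable {dv dc : ℕ} {Y M U : Type*} [MeasurableSpace Y] [MeasurableSpace M] [MeasurableSpace U]

open Classical in
/-- A changed message comes from a changed edge, from a changed input or a redirected edge at the
same check node (`dc` messages each), or from changed noise. -/
theorem hammingDist_checkStep_le {n m : ℕ} (D : NoisySystem dv dc Y M U)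
    (g g' : FactorGraph n dv m dc) (t : ℕ) (prev prev' : Fin n × Fin dv → M) (u u' : Fin m → U)
    (w w' : Fin n × Fin dv → M) :
    hammingDist (D.checkStep g t prev u w) (D.checkStep g' t prev' u' w') ≤
      hammingDist g g' + dc * (hammingDist g g' + hammingDist prev prev') +
        dc * hammingDist u u' + hammingDist w w' := by
  let G := Finset.univ.filter fun x => g x ≠ g' x
  let P := Finset.univ.filter fun x => prev x ≠ prev' x
  let V := Finset.univ.filter fun j => u j ≠ u' j
  let W := Finset.univ.filter fun x => w x ≠ w' x
  let nb : Fin m → Finset (Fin n × Fin dv) := fun j =>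
    Finset.univ.image fun k : Fin dc => g.symm (j, k)
  have hnb : ∀ j, (nb j).card ≤ dc := fun j => Finset.card_image_le.trans (by simp)
  have hsub : (Finset.univ.filter fun e =>
      D.checkStep g t prev u w e ≠ D.checkStep g' t prev' u' w' e) ⊆
      ((G ∪ (G ∪ P).biUnion fun x => nb (g x).1) ∪ V.biUnion nb) ∪ W := by
    intro e he
    by_contra hcon
    simp only [Finset.mem_union, not_or] at hcon
    obtain ⟨⟨⟨h1, h2⟩, h3⟩, h4⟩ := hcon
    have h1' : g e = g' e := by simpa [G] using h1
    have h4' : w e = w' e := by simpa [W] using h4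
    have hmem : e ∈ nb (g e).1 :=
      Finset.mem_image.2 ⟨(g e).2, Finset.mem_univ _, by simp⟩
    have h3' : u (g e).1 = u' (g e).1 := by
      by_contra h
      exact h3 (Finset.mem_biUnion.2 ⟨(g e).1, by simpa [V] using h, hmem⟩)
    have h2' : ∀ k, prev (g.symm ((g e).1, k)) = prev' (g'.symm ((g e).1, k)) := fun k => by
      have hx : g.symm ((g e).1, k) ∉ G ∪ P := fun h =>
        h2 (Finset.mem_biUnion.2 ⟨_, h, by simpa using hmem⟩)
      simp only [G, P, Finset.mem_union, Finset.mem_filter, Finset.mem_univ, true_and, not_or,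
        not_not, Equiv.apply_symm_apply] at hx
      rw [hx.2, (g'.symm_apply_eq).2 hx.1]
    refine (Finset.mem_filter.1 he).2 ?_
    simp only [checkStep, ← h1', h2', h3', h4']
  have hW : hammingDist w w' = W.card := rfl
  calc _ ≤ _ := Finset.card_le_card hsub
    _ ≤ _ := Finset.card_union_le _ _
    _ ≤ _ := by
      rw [hW]
      refine Nat.add_le_add_right ((Finset.card_union_le _ _).trans (Nat.add_le_add
        ((Finset.card_union_le _ _).trans (Nat.add_le_add le_rfl ?_)) ?_)) _
      · refine (Finset.card_biUnion_le_card_mul _ _ _ fun x _ => hnb _).trans ?_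
        rw [mul_comm]
        exact Nat.mul_le_mul_left _ (Finset.card_union_le _ _)
      · refine (Finset.card_biUnion_le_card_mul _ _ _ fun x _ => hnb _).trans ?_
        rw [mul_comm]; rfl

open Classical in
theorem hammingDist_varStep_le {n : ℕ} (D : NoisySystem dv dc Y M U) (t : ℕ) (y y' : Fin n → Y)
    (inc inc' : Fin n × Fin dv → M) (u u' : Fin n → U) (w w' : Fin n × Fin dv → M) :
    hammingDist (D.varStep t y inc u w) (D.varStep t y' inc' u' w') ≤
      dv * hammingDist y y' + dv * hammingDist inc inc' + dv * hammingDist u u' +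
        hammingDist w w' := by
  let A := Finset.univ.filter fun x => y x ≠ y' x
  let P := Finset.univ.filter fun x => inc x ≠ inc' x
  let V := Finset.univ.filter fun j => u j ≠ u' j
  let W := Finset.univ.filter fun x => w x ≠ w' x
  let nb : Fin n → Finset (Fin n × Fin dv) := fun i => Finset.univ.image fun k : Fin dv => (i, k)
  have hnb : ∀ j, (nb j).card ≤ dv := fun j => Finset.card_image_le.trans (by simp)
  have hsub : (Finset.univ.filter fun e =>
      D.varStep t y inc u w e ≠ D.varStep t y' inc' u' w' e) ⊆
      ((A.biUnion nb ∪ P.biUnion fun x => nb x.1) ∪ V.biUnion nb) ∪ W := by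
    intro e he
    by_contra hcon
    simp only [Finset.mem_union, not_or] at hcon
    obtain ⟨⟨⟨h1, h2⟩, h3⟩, h4⟩ := hcon
    have h4' : w e = w' e := by simpa [W] using h4
    have hmem : e ∈ nb e.1 := Finset.mem_image.2 ⟨e.2, Finset.mem_univ _, rfl⟩
    have h1' : y e.1 = y' e.1 := by
      by_contra h
      exact h1 (Finset.mem_biUnion.2 ⟨e.1, by simpa [A] using h, hmem⟩)
    have h3' : u e.1 = u' e.1 := by
      by_contra h
      exact h3 (Finset.mem_biUnion.2 ⟨e.1, by simpa [V] using h, hmem⟩)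
    have h2' : ∀ k, inc (e.1, k) = inc' (e.1, k) := fun k => by
      by_contra h
      exact h2 (Finset.mem_biUnion.2 ⟨(e.1, k), by simpa [P] using h, hmem⟩)
    refine (Finset.mem_filter.1 he).2 ?_
    simp only [varStep, h1', h2', h3', h4']
  have hW : hammingDist w w' = W.card := rfl
  have hb : ∀ {ι : Type} (S : Finset ι) (f : ι → Fin n),
      (S.biUnion fun x => nb (f x)).card ≤ dv * S.card := fun S f =>
    (Finset.card_biUnion_le_card_mul _ _ _ fun x _ => hnb _).trans (mul_comm _ _).le
  calc _ ≤ _ := Finset.card_le_card hsub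
    _ ≤ _ := Finset.card_union_le _ _
    _ ≤ _ := by
      rw [hW]
      exact Nat.add_le_add_right ((Finset.card_union_le _ _).trans (Nat.add_le_add
        ((Finset.card_union_le _ _).trans (Nat.add_le_add (hb A id) (hb P Prod.fst)))
        (hb V id))) _

/-- A bound, uniform in the size of the graph, for the number of messages of iteration `t` that
change when one noise variable is replaced or two edges of the graph are switched. -/
def influence (dv dc : ℕ) : ℕ → ℕ
  | 0 => 4 * dv + 2
  | t + 1 => dv * 2 + dv * (2 + dc * (2 + influence dv dc t) + dc * 2 + 2) + dv * 2 + 2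

open Classical in
theorem hammingDist_received_le {n m ℓ : ℕ} (D : NoisySystem dv dc Y M U)
    {g g' : FactorGraph n dv m dc} {y y' : Fin n → Y} {uv uv' : Fin (ℓ + 1) → Fin n → U}
    {wvc wvc' : Fin (ℓ + 1) → Fin n × Fin dv → M} {uc uc' : Fin ℓ → Fin m → U}
    {wcv wcv' : Fin ℓ → Fin n × Fin dv → M} (hg : hammingDist g g' ≤ 2)
    (hy : hammingDist y y' ≤ 2) (huv : ∀ t, hammingDist (uv t) (uv' t) ≤ 2)
    (hwvc : ∀ t, hammingDist (wvc t) (wvc' t) ≤ 2) (huc : ∀ t, hammingDist (uc t) (uc' t) ≤ 2)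
    (hwcv : ∀ t, hammingDist (wcv t) (wcv' t) ≤ 2) :
    ∀ (t : ℕ) (ht : t ≤ ℓ), hammingDist (D.received g y uv wvc uc wcv t ht)
      (D.received g' y' uv' wvc' uc' wcv' t ht) ≤ influence dv dc t
  | 0, ht => by
      -- Iteration `0` is a variable node step whose map ignores the incoming messages.
      let D' : NoisySystem dv dc Y M U := { D with
        varMap := fun _ y _ u => D.varInit y u
        measurable_varMap := fun _ => D.measurable_varInit.comp
          (f := fun x : Y × (Fin (dv - 1) → M) × U => (x.1, x.2.2)) (by fun_prop) }
      have h := hammingDist_varStep_le D' 0 y y' (wvc 0) (wvc 0) (uv 0) (uv' 0) (wvc 0) (wvc' 0)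
      rw [hammingDist_self] at h
      refine h.trans ?_
      have h1 := Nat.mul_le_mul_left dv hy
      have h2 := Nat.mul_le_mul_left dv (huv 0)
      have h3 := hwvc 0
      simp only [influence]
      omega
  | t + 1, ht => by
      have ih := hammingDist_received_le D hg hy huv hwvc huc hwcv t (by omega)
      refine (hammingDist_varStep_le D _ _ _ _ _ _ _ _ _).trans ?_
      simp only [influence]
      gcongr
      · refine (hammingDist_checkStep_le D _ _ _ _ _ _ _ _ _).trans ?_
        gcongr
        · exact huc _
        · exact hwcv _
      · exact huv _
      · exact hwvc _

/-- Two realizations that differ in one noise variable or by a switch of two edges. -/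
def OneChange (n m ℓ : ℕ) (dv dc : ℕ) (Y M U : Type*) :
    SampleSpace n dv m dc Y M U ℓ → SampleSpace n dv m dc Y M U ℓ → Prop :=
  ProdRel SwapRel <| ProdRel (PiRel fun _ _ => True) <|
    ProdRel (PiRel <| PiRel fun _ _ => True) <| ProdRel (PiRel <| PiRel fun _ _ => True) <|
    ProdRel (PiRel <| PiRel fun _ _ => True) (PiRel <| PiRel fun _ _ => True)

theorem abs_numIncorrect_sub_le {n m ℓ : ℕ} (D : NoisySystem dv dc Y M U)
    {ω ω' : SampleSpace n dv m dc Y M U ℓ} (h : OneChange n m ℓ dv dc Y M U ω ω') :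
    |(D.numIncorrect ω : ℝ) - D.numIncorrect ω'| ≤ influence dv dc ℓ := by
  classical
  obtain ⟨g, y, uv, wvc, uc, wcv⟩ := ω
  obtain ⟨g', y', uv', wvc', uc', wcv'⟩ := ω'
  have hmsg : hammingDist (D.received g y uv wvc uc wcv ℓ le_rfl)
      (D.received g' y' uv' wvc' uc' wcv' ℓ le_rfl) ≤ influence dv dc ℓ := by
    have key : hammingDist (g : _ → _) g' ≤ 2 ∧ hammingDist y y' ≤ 2 ∧
        (∀ t, hammingDist (uv t) (uv' t) ≤ 2) ∧ (∀ t, hammingDist (wvc t) (wvc' t) ≤ 2) ∧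
        (∀ t, hammingDist (uc t) (uc' t) ≤ 2) ∧ (∀ t, hammingDist (wcv t) (wcv' t) ≤ 2) := by
      simp only [OneChange, ProdRel, Prod.mk.injEq] at h
      rcases h with ⟨h, rfl, rfl, rfl, rfl, rfl⟩ | ⟨rfl, ⟨h, rfl, rfl, rfl, rfl⟩ |
        ⟨rfl, ⟨h, rfl, rfl, rfl⟩ | ⟨rfl, ⟨h, rfl, rfl⟩ | ⟨rfl, ⟨h, rfl⟩ | ⟨rfl, h⟩⟩⟩⟩⟩
      · simpa using hammingDist_le_of_swapRel h
      · simpa using hammingDist_le_of_piRel h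
      all_goals simpa using hammingDist_le_of_piRel_piRel h
    obtain ⟨h1, h2, h3, h4, h5, h6⟩ := key
    exact hammingDist_received_le D h1 h2 h3 h4 h5 h6 ℓ le_rfl
  refine le_trans ?_ (Nat.cast_le.2 hmsg)
  simp only [numIncorrect, Nat.cast_sum, ← Finset.sum_sub_distrib]
  refine (Finset.abs_sum_le_sum_abs _ _).trans ?_
  rw [hammingDist, Finset.card_filter, Nat.cast_sum]
  refine Finset.sum_le_sum fun e _ => ?_
  simp only [message, Set.indicator_apply]
  by_cases he : D.received g y uv wvc uc wcv ℓ le_rfl e =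
    D.received g' y' uv' wvc' uc' wcv' ℓ le_rfl e
  · simp [he]
  · rw [if_pos he]
    split_ifs <;> simp

end NoisySystem

/-! ### The conditional error probability and the bias -/

namespace NoisySystem

variable {dv dc : ℕ} {Y M U : Type*} [MeasurableSpace Y] [MeasurableSpace M] [MeasurableSpace U]

theorem nonempty_factorGraph {n m dv dc : ℕ} (h : n * dv = m * dc) :
    Nonempty (FactorGraph n dv m dc) :=
  ⟨Fintype.equivOfCardEq (by simpa using h)⟩

theorem isProbabilityMeasure_uniformOn_factorGraph {n m dv dc : ℕ} (h : n * dv = m * dc) :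
    IsProbabilityMeasure (uniformOn (Set.univ : Set (FactorGraph n dv m dc))) :=
  have := nonempty_factorGraph h
  isProbabilityMeasure_uniformOn Set.finite_univ Set.univ_nonempty

theorem isProbabilityMeasure_law (D : NoisySystem dv dc Y M U) {n m : ℕ} (ℓ : ℕ)
    (h : n * dv = m * dc) : IsProbabilityMeasure (D.law n m ℓ) := by
  have := isProbabilityMeasure_uniformOn_factorGraph h
  rw [law_eq]
  infer_instance

theorem measurableSet_treeEvent {n m ℓ : ℕ} (e : Fin n × Fin dv) :
    MeasurableSet (treeEvent Y M U e : Set (SampleSpace n dv m dc Y M U ℓ)) :=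
  measurable_fst (MeasurableSpace.measurableSet_top (s := {g | TreeLike g e (2 * ℓ)}))

theorem measurableSet_message_incorrect {n m ℓ : ℕ} (D : NoisySystem dv dc Y M U)
    (e : Fin n × Fin dv) :
    MeasurableSet {ω : SampleSpace n dv m dc Y M U ℓ | D.message e ω ∈ D.incorrect} :=
  D.measurable_message e D.measurableSet_incorrect

theorem law_real_treeEvent_inter {n m ℓ : ℕ} (D : NoisySystem dv dc Y M U)
    (e : Fin n × Fin dv) :
    (D.law n m ℓ).real (treeEvent Y M U e ∩ {ω | D.message e ω ∈ D.incorrect}) =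
      (D.law n m ℓ).real (treeEvent Y M U e) * D.treeError ℓ := by
  have hT : (D.law n m ℓ) (treeEvent Y M U e) =
      uniformOn (Set.univ : Set (FactorGraph n dv m dc)) {g | TreeLike g e (2 * ℓ)} := by
    have : (treeEvent Y M U e : Set (SampleSpace n dv m dc Y M U ℓ)) =
        {g | TreeLike g e (2 * ℓ)} ×ˢ Set.univ := by ext; simp [treeEvent]
    rw [this, law_eq, Measure.prod_prod, measure_univ, mul_one]
  have hTA : (D.law n m ℓ) (treeEvent Y M U e ∩ {ω | D.message e ω ∈ D.incorrect}) =
      ENNReal.ofReal (D.treeError ℓ) *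
        uniformOn (Set.univ : Set (FactorGraph n dv m dc)) {g | TreeLike g e (2 * ℓ)} := by
    rw [law_eq, Measure.prod_apply
      ((measurableSet_treeEvent e).inter (D.measurableSet_message_incorrect e)),
      ← lintegral_indicator_const MeasurableSpace.measurableSet_top]
    refine lintegral_congr fun g => ?_
    by_cases hg : TreeLike g e (2 * ℓ)
    · rw [Set.indicator_of_mem (by exact hg), ← D.measureReal_incorrect_of_treeLike hg,
        ofReal_measureReal]
      congr 1
      ext ω
      simp [treeEvent, hg]
    · rw [Set.indicator_of_notMem (by exact hg)]
      exact (congrArg _ (Set.eq_empty_of_forall_notMem fun ω hω => hg hω.1)).trans measure_empty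
  rw [Measure.real, Measure.real, hTA, hT, ENNReal.toReal_mul, mul_comm,
    ENNReal.toReal_ofReal (by unfold treeError; exact measureReal_nonneg)]

theorem cond_law_real_incorrect {n m ℓ : ℕ} (D : NoisySystem dv dc Y M U)
    (h : n * dv = m * dc) (e : Fin n × Fin dv)
    (he : D.law n m ℓ (treeEvent Y M U e) ≠ 0) :
    (ProbabilityTheory.cond (D.law n m ℓ) (treeEvent Y M U e)).real
      {ω | D.message e ω ∈ D.incorrect} = D.treeError ℓ := by
  have := D.isProbabilityMeasure_law ℓ h
  rw [Measure.real, cond_apply (measurableSet_treeEvent e), ENNReal.toReal_mul,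
    ENNReal.toReal_inv, ← Measure.real, ← Measure.real, law_real_treeEvent_inter, ← mul_assoc,
    inv_mul_cancel₀ ((measureReal_ne_zero_iff (measure_ne_top _ _)).2 he), one_mul]

theorem abs_law_real_incorrect_sub_le {n m ℓ : ℕ} (D : NoisySystem dv dc Y M U)
    (h : n * dv = m * dc) (e : Fin n × Fin dv) :
    |(D.law n m ℓ).real {ω | D.message e ω ∈ D.incorrect} - D.treeError ℓ| ≤
      (D.law n m ℓ).real (treeEvent Y M U e)ᶜ := by
  have := D.isProbabilityMeasure_law ℓ h
  set A := {ω : SampleSpace n dv m dc Y M U ℓ | D.message e ω ∈ D.incorrect}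
  have h1 := measureReal_inter_add_sdiff (μ := D.law n m ℓ) (s := A)
    (measurableSet_treeEvent (Y := Y) (M := M) (U := U) (ℓ := ℓ) (dc := dc) (m := m) e)
  rw [Set.inter_comm, law_real_treeEvent_inter] at h1
  have h2 : (D.law n m ℓ).real (A \ treeEvent Y M U e) ≤
      (D.law n m ℓ).real (treeEvent Y M U e)ᶜ := measureReal_mono fun _ hx => hx.2
  have h3 := probReal_add_probReal_compl (μ := D.law n m ℓ)
    (measurableSet_treeEvent (Y := Y) (M := M) (U := U) (ℓ := ℓ) (dc := dc) (m := m) e)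
  have h4 : 0 ≤ D.treeError ℓ := measureReal_nonneg
  have h5 : D.treeError ℓ ≤ 1 := measureReal_le_one
  have h6 : 0 ≤ (D.law n m ℓ).real (A \ treeEvent Y M U e) := measureReal_nonneg
  have h7 : 0 ≤ (D.law n m ℓ).real (treeEvent Y M U e)ᶜ := measureReal_nonneg
  rw [abs_le]
  constructor <;> nlinarith

/-- A bound for the expected number of edges without tree-like neighborhood, and so for the bias of
the number of incorrect messages. -/
def biasConst (dv dc ℓ : ℕ) : ℕ := 2 * (((1 + dv + dc) ^ (2 * ℓ)) ^ 2 * (dv * dc)) + 8 * ℓ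

/-- `card_not_treeLike_mul_le` is void when `n * dv ≤ 4 * ℓ`, so it is used for `8 * ℓ ≤ n * dv`
only; for smaller graphs the term `8 * ℓ` of `biasConst` makes the bound trivial. -/
theorem mul_law_real_compl_treeEvent_le {n m ℓ : ℕ} (D : NoisySystem dv dc Y M U)
    (h : n * dv = m * dc) (e : Fin n × Fin dv) :
    (n * dv : ℝ) * (D.law n m ℓ).real (treeEvent Y M U e)ᶜ ≤ biasConst dv dc ℓ := by
  classical
  have := nonempty_factorGraph h
  have hcard := card_not_treeLike_mul_le (m := m) (dc := dc) e (2 * ℓ)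
  set F := Fintype.card (FactorGraph n dv m dc) with hF
  set bad := Finset.univ.filter fun g : FactorGraph n dv m dc => ¬ TreeLike g e (2 * ℓ) with hbad
  have hF0 : 0 < F := Fintype.card_pos
  have hle : bad.card ≤ F := Finset.card_le_univ _
  have hnat : n * dv * bad.card ≤ biasConst dv dc ℓ * F := by
    unfold biasConst
    set C := ((1 + dv + dc) ^ (2 * ℓ)) ^ 2 * (dv * dc)
    by_cases hN : 8 * ℓ ≤ n * dv
    · have h1 : n * dv ≤ 2 * (n * dv - 2 * (2 * ℓ)) := by omega
      calc n * dv * bad.card ≤ 2 * (n * dv - 2 * (2 * ℓ)) * bad.card := Nat.mul_le_mul_right _ h1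
        _ = 2 * (bad.card * (n * dv - 2 * (2 * ℓ))) := by ring
        _ ≤ 2 * (F * C) := Nat.mul_le_mul_left _ hcard
        _ ≤ (2 * C + 8 * ℓ) * F := by nlinarith [Nat.zero_le (ℓ * F)]
    · calc n * dv * bad.card ≤ 8 * ℓ * F := Nat.mul_le_mul (by omega) hle
        _ ≤ (2 * C + 8 * ℓ) * F := Nat.mul_le_mul_right _ (by omega)
  have hlaw : (D.law n m ℓ).real (treeEvent Y M U e)ᶜ = bad.card / F := by
    have h1 : (treeEvent Y M U e : Set (SampleSpace n dv m dc Y M U ℓ))ᶜ =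
        (bad : Set (FactorGraph n dv m dc)) ×ˢ Set.univ := by ext; simp [treeEvent, hbad]
    rw [h1, law_eq, Measure.real, Measure.prod_prod, measure_univ, mul_one, uniformOn_univ,
      Measure.count_apply_finset, ENNReal.toReal_div]
    simp [hF]
  have hF' : (0 : ℝ) < F := by exact_mod_cast hF0
  rw [hlaw, ← mul_div_assoc, div_le_iff₀ hF']
  exact_mod_cast hnat

theorem numIncorrect_eq_sum {n m ℓ : ℕ} (D : NoisySystem dv dc Y M U)
    (ω : SampleSpace n dv m dc Y M U ℓ) : (D.numIncorrect ω : ℝ) =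
      ∑ e : Fin n × Fin dv, {ω | D.message e ω ∈ D.incorrect}.indicator (fun _ => (1 : ℝ)) ω := by
  classical
  simp [numIncorrect, Set.indicator_apply]

theorem measurable_numIncorrect {n m ℓ : ℕ} (D : NoisySystem dv dc Y M U) :
    Measurable fun ω : SampleSpace n dv m dc Y M U ℓ => (D.numIncorrect ω : ℝ) := by
  simp_rw [numIncorrect_eq_sum]
  exact Finset.measurable_fun_sum _ fun e _ =>
    measurable_const.indicator (D.measurableSet_message_incorrect e)

theorem abs_integral_numIncorrect_sub_le {n m ℓ : ℕ} (D : NoisySystem dv dc Y M U)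
    (h : n * dv = m * dc) (hN : 0 < n * dv) :
    |∫ ω, (D.numIncorrect ω : ℝ) ∂(D.law n m ℓ) - n * dv * D.treeError ℓ| ≤
      biasConst dv dc ℓ := by
  have := D.isProbabilityMeasure_law ℓ h
  have h1 : ∫ ω, (D.numIncorrect ω : ℝ) ∂(D.law n m ℓ) =
      ∑ e : Fin n × Fin dv, (D.law n m ℓ).real {ω | D.message e ω ∈ D.incorrect} := by
    simp_rw [numIncorrect_eq_sum]
    rw [integral_finsetSum]
    · refine Finset.sum_congr rfl fun e _ => ?_
      rw [integral_indicator_const _ (D.measurableSet_message_incorrect e)]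
      simp
    · exact fun e _ => (integrable_const _).indicator (D.measurableSet_message_incorrect e)
  have h2 : (n * dv * D.treeError ℓ : ℝ) = ∑ _e : Fin n × Fin dv, D.treeError ℓ := by simp
  have hN' : (0 : ℝ) < n * dv := by exact_mod_cast hN
  rw [h1, h2, ← Finset.sum_sub_distrib]
  calc _ ≤ ∑ e : Fin n × Fin dv, (biasConst dv dc ℓ : ℝ) / (n * dv) := by
        refine (Finset.abs_sum_le_sum_abs _ _).trans (Finset.sum_le_sum fun e _ => ?_)
        refine (D.abs_law_real_incorrect_sub_le h e).trans ?_
        rw [le_div_iff₀ hN', mul_comm]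
        exact D.mul_law_real_compl_treeEvent_le h e
    _ = biasConst dv dc ℓ := by
        simp only [Finset.sum_const, Finset.card_univ, Fintype.card_prod, Fintype.card_fin,
          nsmul_eq_mul, Nat.cast_mul]
        exact mul_div_cancel₀ _ hN'.ne'

end NoisySystem

/-! ### Deviation from the mean -/

namespace NoisySystem

variable {dv dc : ℕ} {Y M U : Type*} [MeasurableSpace Y] [MeasurableSpace M] [MeasurableSpace U]

/-- `n * varianceConst dv ℓ` bounds the number of independent variables, where each of the `n * dv`
edges counts `4` as in `subgaussianDiff_perm`. -/
def varianceConst (dv ℓ : ℕ) : ℕ :=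
  4 * dv + 1 + (ℓ + 1) + (ℓ + 1) * dv + ℓ * dv + ℓ * dv

theorem subgaussianDiff_law {n m ℓ : ℕ} (D : NoisySystem dv dc Y M U)
    (h : n * dv = m * dc) (hdc : 1 ≤ dc) :
    SubgaussianDiff (D.law n m ℓ) (OneChange n m ℓ dv dc Y M U) (n * varianceConst dv ℓ : ℕ) := by
  have := isProbabilityMeasure_uniformOn_factorGraph h
  refine SubgaussianDiff.mono ((subgaussianDiff_equiv (by simpa using h)).prod
    ((SubgaussianDiff.pi _ fun _ => .univ _).prod
    ((SubgaussianDiff.pi _ fun _ => .pi _ fun _ => .univ _).prod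
    ((SubgaussianDiff.pi _ fun _ => .pi _ fun _ => .univ _).prod
    ((SubgaussianDiff.pi _ fun _ => .pi _ fun _ => .univ _).prod
    (SubgaussianDiff.pi _ fun _ => .pi _ fun _ => .univ _)))))) ?_
  simp only [Fintype.card_prod, Fintype.card_fin, mul_one]
  have hm : m ≤ n * dv := by rw [h]; exact Nat.le_mul_of_pos_right _ hdc
  have : 4 * (n * dv) + (n + ((ℓ + 1) * n + ((ℓ + 1) * (n * dv) + (ℓ * m + ℓ * (n * dv))))) ≤
      n * varianceConst dv ℓ := by
    unfold varianceConst
    nlinarith [Nat.mul_le_mul_left ℓ hm]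
  exact_mod_cast this

theorem law_real_abs_numIncorrect_sub_integral_ge {n m ℓ : ℕ} (D : NoisySystem dv dc Y M U)
    (h : n * dv = m * dc) (hdc : 1 ≤ dc) {s : ℝ} (hs : 0 ≤ s) :
    (D.law n m ℓ).real
      {ω | s ≤ |(D.numIncorrect ω : ℝ) - ∫ ω, (D.numIncorrect ω : ℝ) ∂(D.law n m ℓ)|} ≤
      2 * Real.exp (-s ^ 2 / (2 * (n * varianceConst dv ℓ * influence dv dc ℓ ^ 2))) := by
  have := D.isProbabilityMeasure_law ℓ h
  have hZ := D.subgaussianDiff_law (ℓ := ℓ) h hdc (fun ω => (D.numIncorrect ω : ℝ)) (n * dv)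
    (influence dv dc ℓ) D.measurable_numIncorrect
    (fun ω => by
      rw [Nat.abs_cast]
      have : D.numIncorrect ω ≤ n * dv := by
        classical
        refine (Finset.sum_le_card_nsmul _ _ 1 fun e _ => ?_).trans (by simp)
        rw [Set.indicator_apply]
        split_ifs <;> simp
      exact_mod_cast this)
    (fun ω ω' hω => by simpa using D.abs_numIncorrect_sub_le hω)
  have h1 := hZ.measure_ge_le hs
  have h2 := hZ.neg.measure_ge_le hs
  push_cast at h1 h2
  set X : SampleSpace n dv m dc Y M U ℓ → ℝ := fun ω =>
    (D.numIncorrect ω : ℝ) - ∫ ω, (D.numIncorrect ω : ℝ) ∂(D.law n m ℓ)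
  have hsub : {ω | s ≤ |X ω|} ⊆ {ω | s ≤ X ω} ∪ {ω | s ≤ (-X) ω} := 
    fun ω (hω : s ≤ |X ω|) => (le_abs.1 hω : s ≤ X ω ∨ s ≤ -X ω)
  calc _ ≤ _ := measureReal_mono hsub
    _ ≤ _ := measureReal_union_le _ _
    _ ≤ _ := by rw [two_mul]; exact add_le_add h1 h2

end NoisySystem

end

theorem theorem4 (dv dc ℓ : ℕ) (hdv : 1 ≤ dv) (hdc : 1 ≤ dc) :
    ∃ β γ : ℝ, 0 < β ∧ 0 < γ ∧
      ∀ (Y M U : Type*) [MeasurableSpace Y] [MeasurableSpace M] [MeasurableSpace U]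
        (D : NoisySystem dv dc Y M U),
        ∃ p : ℝ,
          -- `p` is the expected number of incorrect messages received in iteration `ℓ` along a
          -- given edge whose directed neighborhood of depth `2 * ℓ` is tree-like
          (∀ (n m : ℕ), n * dv = m * dc → ∀ e : Fin n × Fin dv,
            D.law n m ℓ (NoisySystem.treeEvent Y M U e) ≠ 0 →
            (ProbabilityTheory.cond (D.law n m ℓ) (NoisySystem.treeEvent Y M U e)).real
              {ω | D.message e ω ∈ D.incorrect} = p) ∧
          ∀ ε : ℝ, 0 < ε → ∀ n m : ℕ, n * dv = m * dc → (n : ℝ) > 2 * γ / ε →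
            (D.law n m ℓ).real
              {ω | |(D.numIncorrect ω : ℝ) - n * dv * p| > n * dv * ε}
                ≤ 2 * Real.exp (-β * ε ^ 2 * n) := by
  have hinf : 0 < NoisySystem.influence dv dc ℓ := by
    cases ℓ <;> simp [NoisySystem.influence]
  have hK : (0 : ℝ) < NoisySystem.influence dv dc ℓ := by exact_mod_cast hinf
  have hvar : 0 < NoisySystem.varianceConst dv ℓ := by unfold NoisySystem.varianceConst; omega
  have hV : (0 : ℝ) < NoisySystem.varianceConst dv ℓ := by exact_mod_cast hvar
  have hdv' : (1 : ℝ) ≤ dv := by exact_mod_cast hdv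
  refine ⟨dv ^ 2 / (8 * (NoisySystem.varianceConst dv ℓ * NoisySystem.influence dv dc ℓ ^ 2)),
    NoisySystem.biasConst dv dc ℓ + 1, by positivity, by positivity, ?_⟩
  intro Y M U _ _ _ D
  refine ⟨D.treeError ℓ, fun n m h e he => D.cond_law_real_incorrect h e he, ?_⟩
  intro ε hε n m h hn
  have := D.isProbabilityMeasure_law ℓ h
  have hn0 : (0 : ℝ) < n := lt_trans (by positivity) hn
  have hbias := D.abs_integral_numIncorrect_sub_le (ℓ := ℓ) h
    (Nat.mul_pos (by exact_mod_cast hn0) hdv)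
  -- The bias is at most half of the deviation; the fluctuation has to make up the other half.
  have hhalf : (NoisySystem.biasConst dv dc ℓ : ℝ) ≤ n * dv * ε / 2 := by
    rw [gt_iff_lt, div_lt_iff₀ hε] at hn
    have : n * ε ≤ n * ε * dv := le_mul_of_one_le_right (by positivity) hdv'
    linarith
  refine (measureReal_mono fun ω hω => ?_).trans
    ((D.law_real_abs_numIncorrect_sub_integral_ge h hdc
      (s := n * dv * ε / 2) (by positivity)).trans_eq ?_)
  · simp only [Set.mem_ofPred_eq] at hω ⊢
    have := abs_sub_le (D.numIncorrect ω : ℝ)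
      (∫ ω, (D.numIncorrect ω : ℝ) ∂(D.law n m ℓ)) (n * dv * D.treeError ℓ)
    linarith
  · congr 2
    field_simp
    ring
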